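/- **Setting.** A generalized link with two arc components $L=(L_1,L_2)$, $L_i:[0,1]\to\mathbb R^3$, is a pair of disjoint continuous arcs, each endpoint $x$ being constrained to an affine subspace $M_x$, and both arcs being constrained to the region where finitely many $C^1$ functions $g_k$, having $0$ as a regular value, are nonnegative. Its Gehring thickness $\mathrm{Thi}(L)$ is the minimal distance between points of $L_1$ and $L_2$, and $O(L)=\min_k\min_{x\in L}g_k(x)$. A continuous vector field $\xi$ along $L$ is compatible if it is tangent to $M_x$ at each endpoint $x$. A rectifiable curve $L_i$ has finite total curvature if its first variation of length is $\delta_\xi\mathrm{Len}(L_i)=-\int\langle\xi,d\mathcal K_i\rangle$ for a vector-valued Radon measure $\mathcal K_i$ along it; the right-hand side then defines $\delta_\xi\mathrm{Len}(L_i)$ for all continuous $\xi$. For weights $w_i$ put $\delta_\xi\mathrm{Len}^w=\sum_i w_i\,\delta_\xi\mathrm{Len}(L_i)$. $L$ is strongly critical for weighted Gehring ropelength if its components have finite total curvature and there is $\varepsilon>0$ such that, for every compatible $\xi$ with $\delta_\xi\mathrm{Len}^w=-1$, the one-sided derivatives $\delta^+_\xi\mathrm{Thi}$ and $\delta^+_\xi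 O$ of $\mathrm{Thi}(L+r\xi)$ and $O(L+r\xi)$ at $r=0^+$ exist and satisfy $\min(\delta^+_\xi\mathrm{Thi},\delta^+_\xi O)\le-\varepsilon$. **The weighted clasp $C(\tau_1,\tau_2)$.** Let $\tau_1,\tau_2\in(0,1]$. Use coordinates $(x_1,x_2,z)$ on $\mathbb R^3$ with unit vectors $e_1,e_2,e_z$, put $\sigma_1=1$, $\sigma_2=-1$ and $n_i^\pm=\pm\sqrt{1-\tau_i^2}\,e_i+\sigma_i\tau_i e_z$. For $c_1,c_2\in\mathbb R$, the endpoints of the $i$th arc are constrained to the planes $\{\langle n_i^\pm,p\rangle=c_i\}$ (at angle $\arcsin\tau_i$ to the vertical), and both arcs have to stay in the region $\langle n_i^\pm,p\rangle\le c_i$ ($i=1,2$). The isotopy class is that of two hooks: polygonal arcs $(-a_i,k_i),(0,h_i),(a_i,k_i)$ in the $x_iz$-planes, $a_i>0$, with $h_1<h_2$ and both tips in the interior of the region. **The configuration.** For $0\le u\le\tau_i$ and $j\ne i$ let $u_j=\tau_j(1-u/\tau_i)$, so that $u/\tau_i+u_j/\tau_j=1$, and let $$x_i(u)=\sqrt{\frac{u^2(1-u_j^2)}{1-u^2u_j^2}},\qquad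 \zeta_i(u)=\int_0^u\frac{s}{\sqrt{1-s^2}}\,x_i'(s)\,ds ,$$ extended to $-\tau_i\le u\le\tau_i$ with $x_i$ odd and $\zeta_i$ even. Let $t_1=0$, $t_2=\sqrt{1-\tau_2^2}+\zeta_2(\tau_2)$, and $\alpha_i(u)=x_i(u)e_i+(t_i+\sigma_i\zeta_i(u))e_z$. Suppose $\langle n_i^+,\alpha_i(\tau_i)\rangle<c_i$ for $i=1,2$ (the planes leave room for the curved arcs), and extend both ends of each $\alpha_i$ by straight segments in the directions $n_i^\pm$ up to the bounding planes. **Theorem.** This pair of arcs is a generalized link for the constraints above and lies in the isotopy class of the clasp. Points $\alpha_1(u_1)$, $\alpha_2(u_2)$ with $|u_1|/\tau_1+|u_2|/\tau_2=1$ are at distance $1$, the Gehring thickness is $1$, and the configuration is strongly critical for weighted Gehring ropelength with weights $w_i=1/\tau_i$. -/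

import Mathlib

open scoped unitInterval

noncomputable section

namespace Clasp

/-- Euclidean three-space, with coordinates `(x₁, x₂, z)` indexed by `0, 1, 2`. -/
abbrev E3 := EuclideanSpace ℝ (Fin 3)

/-! ### Generalized links whose components are arcs -/

/-- The constraints of a generalized link all of whose components (indexed by `ι`) are arcs:
an affine subspace for each endpoint (`false` for the initial and `true` for the final one),
and obstacles `{p | g p < 0}` indexed by `κ`. -/
structure Constraints (ι κ : Type) where
  endpoint : ι → Bool → AffineSubspace ℝ E3
  obstacle : κ → E3 → ℝ

variable {ι κ : Type}

/-- `L` is a generalized link for the constraints `C`: the obstacle functions are `C¹` with `0`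
as a regular value, and `L` consists of disjoint arcs that obey the constraints. -/
structure IsGeneralizedLink (C : Constraints ι κ) (L : ι → I → E3) : Prop where
  obstacle_contDiff : ∀ k, ContDiff ℝ 1 (C.obstacle k)
  obstacle_regular : ∀ k p, C.obstacle k p = 0 → fderiv ℝ (C.obstacle k) p ≠ 0
  continuous : ∀ i, Continuous (L i)
  disjoint : ∀ i j, i ≠ j → ∀ s t, L i s ≠ L j t
  start_mem : ∀ i, L i 0 ∈ C.endpoint i false
  end_mem : ∀ i, L i 1 ∈ C.endpoint i true
  avoids : ∀ k i t, 0 ≤ C.obstacle k (L i t)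

/-- An isotopy between two generalized links with the same constraints: a continuous family of
generalized links whose components are embedded arcs. -/
def Isotopic (C : Constraints ι κ) (L L' : ι → I → E3) : Prop :=
  ∃ H : I → ι → I → E3,
    (∀ i, Continuous fun q : I × I => H q.1 i q.2) ∧ H 0 = L ∧ H 1 = L' ∧
    ∀ r, IsGeneralizedLink C (H r) ∧ ∀ i, Function.Injective (H r i)

/-- The Gehring thickness: the minimal distance between points on different components. -/
def gThi (L : ι → I → E3) : ℝ :=
  sInf {d | ∃ i j, i ≠ j ∧ ∃ s t, d = dist (L i s) (L j t)}

/-- The obstacle function `O(L)`, the minimum of all obstacle functions over the link. -/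
def obstacleMin (C : Constraints ι κ) (L : ι → I → E3) : ℝ :=
  ⨅ q : κ × ι × I, C.obstacle q.1 (L q.2.1 q.2.2)

/-- The link obtained by moving `L` along the vector field `ξ` for time `r`. -/
def vary (L : ι → I → E3) (ξ : ι → C(I, E3)) (r : ℝ) : ι → I → E3 :=
  fun i t => L i t + r • ξ i t

/-- `d` is the one-sided first variation of the functional `Φ` at `L` in the direction `ξ`. -/
def HasOneSidedVariation (Φ : (ι → I → E3) → ℝ) (L : ι → I → E3) (ξ : ι → C(I, E3))
    (d : ℝ) : Prop :=
  HasDerivWithinAt (fun r => Φ (vary L ξ r)) d (Set.Ici 0) 0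

/-- A continuous vector field along a link is compatible if it is tangent to the constraining
affine subspaces at the endpoints. -/
def Compatible (C : Constraints ι κ) (ξ : ι → C(I, E3)) : Prop :=
  ∀ i, ξ i 0 ∈ (C.endpoint i false).direction ∧ ξ i 1 ∈ (C.endpoint i true).direction

/-- The length of a curve. -/
def len (γ : I → E3) : ℝ := (eVariationOn γ Set.univ).toReal

/-- The rectifiable curve `γ` has finite total curvature, with curvature force `K`: a
vector-valued Radon measure along `γ`, that is, a continuous linear functional on continuous
vector fields, such that the first variation of length along every `C¹` vector field `ξ` is
`-K ξ`. (`K` includes the atoms at the two endpoints. As `C¹` fields are dense, `K` is unique.) -/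
def IsCurvatureForce (γ : I → E3) (K : C(I, E3) →L[ℝ] ℝ) : Prop :=
  eVariationOn γ Set.univ ≠ ⊤ ∧
  ∀ (ξ : C(I, E3)) (f : ℝ → E3), ContDiff ℝ 1 f → (∀ t : I, ξ t = f t) →
    HasDerivAt (fun r : ℝ => len (fun t => γ t + r • ξ t)) (-(K ξ)) 0

/-- Strong criticality for minimizing weighted length (with weights `w`) when constrained by
Gehring thickness: the components have finite total curvature, and for some `ε > 0`, every
compatible continuous `ξ` with first variation of weighted length `-1` decreases the thickness
or the obstacle function to first order at rate at least `ε`. -/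
def StronglyCritical [Fintype ι] (C : Constraints ι κ) (w : ι → ℝ) (L : ι → I → E3) : Prop :=
  ∃ K : ι → C(I, E3) →L[ℝ] ℝ, (∀ i, IsCurvatureForce (L i) (K i)) ∧
    ∃ ε : ℝ, 0 < ε ∧ ∀ ξ : ι → C(I, E3), Compatible C ξ →
      ∑ i, w i * -(K i (ξ i)) = -1 →
      ∃ dT dO : ℝ, HasOneSidedVariation gThi L ξ dT ∧
        HasOneSidedVariation (obstacleMin C) L ξ dO ∧ min dT dO ≤ -ε

/-! ### The weighted clasp problem `C(τ₁, τ₂)`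

Component `0` is attached to the two upper planes and component `1` to the two lower ones. -/

/-- The point with coordinates `(x, z)` in the `xᵢz`-plane. -/
def planePoint (i : Fin 2) (x z : ℝ) : E3 :=
  EuclideanSpace.single i.castSucc x + EuclideanSpace.single 2 z

/-- `+1` for the component going up from its tip, `-1` for the one going down. -/
def updown (i : Fin 2) : ℝ := if i = 0 then 1 else -1

/-- The outward unit normal (at angle `arcsin τᵢ` to the horizontal) of the plane that
constrains the initial (`false`) or final (`true`) endpoint of component `i`. -/
def normal (τ : Fin 2 → ℝ) (i : Fin 2) (b : Bool) : E3 :=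
  planePoint i ((if b then 1 else -1) * √(1 - τ i ^ 2)) (updown i * τ i)

/-- The constraints of `C(τ₁, τ₂)`: the planes `{p | ⟨n, p⟩ = cᵢ}` at signed distance `cᵢ` from
the origin; the complement of the region which they bound is the obstacle. -/
def claspConstraints (τ c : Fin 2 → ℝ) : Constraints (Fin 2) (Fin 2 × Bool) where
  endpoint i b := AffineSubspace.mk' (c i • normal τ i b) (ℝ ∙ normal τ i b)ᗮ
  obstacle k p := c k.1 - inner ℝ (normal τ k.1 k.2) p

/-- The polygonal arc in the `xᵢz`-plane with vertices `(-a, k)`, `(0, h)`, `(a, k)`. -/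
def hookArc (a h k : ℝ) (i : Fin 2) (t : I) : E3 :=
  planePoint i ((2 * (t : ℝ) - 1) * a) (h + |2 * (t : ℝ) - 1| * (k - h))

/-- The isotopy class of the clasp, through its simplest representatives: two hooked polygonal
arcs in perpendicular planes, the tip of the upper arc lying below the tip of the lower arc and
both tips lying inside the tetrahedron. (So if each arc is closed within the planes of its
endpoints, the two closed curves cross the `z`-axis alternately and form a Hopf link.) -/
def InClaspClass (τ c : Fin 2 → ℝ) (L : Fin 2 → I → E3) : Prop :=
  ∃ a h k : Fin 2 → ℝ, (∀ i, 0 < a i) ∧ h 0 < h 1 ∧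
    (∀ i j b, inner ℝ (normal τ j b) (planePoint i 0 (h i)) < c j) ∧
    Isotopic (claspConstraints τ c) L (fun i => hookArc (a i) (h i) (k i) i)

/-! ### The explicit configuration -/

/-- The modulus `uⱼ` of the parameter on the other arc which is paired with `uᵢ = u` by the
balance relation `|u₁| / τ₁ + |u₂| / τ₂ = 1`. -/
def partner (τ : Fin 2 → ℝ) (i : Fin 2) (u : ℝ) : ℝ := τ i.rev * (1 - |u| / τ i)

/-- The coordinate `xᵢ` at parameter `uᵢ = u`, extended as an odd function. -/
def claspX (τ : Fin 2 → ℝ) (i : Fin 2) (u : ℝ) : ℝ :=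
  u * √((1 - partner τ i u ^ 2) / (1 - u ^ 2 * partner τ i u ^ 2))

/-- The height of the point with parameter `u` over the tip (below the tip for the second
component), from `dz / dxᵢ = uᵢ / √(1 - uᵢ²)`. -/
def claspRise (τ : Fin 2 → ℝ) (i : Fin 2) (u : ℝ) : ℝ :=
  ∫ s in (0 : ℝ)..|u|, s / √(1 - s ^ 2) * deriv (claspX τ i) s

/-- The `z`-coordinate of the tip: `0` for the first component. The tip of the second component
is placed so that the strut from the first tip (`u₁ = 0`, hence `u₂ = τ₂ = x₂`) has length `1`. -/
def tipHeight (τ : Fin 2 → ℝ) (i : Fin 2) : ℝ :=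
  if i = 0 then 0 else √(1 - τ 1 ^ 2) + claspRise τ 1 (τ 1)

/-- The `i`th clasp curve. For `|s| ≤ τᵢ` the parameter `s` is `uᵢ`; outside this interval the
curve continues straight, parametrized by arclength. -/
def arcPoint (τ : Fin 2 → ℝ) (i : Fin 2) (s : ℝ) : E3 :=
  let u := max (-τ i) (min (τ i) s)
  planePoint i (claspX τ i u + (s - u) * √(1 - τ i ^ 2))
    (tipHeight τ i + updown i * (claspRise τ i u + (|s| - |u|) * τ i))

/-- The level, in the direction of the normal of its plane, at which the curved part of the
`i`th arc ends. -/
def bendLevel (τ : Fin 2 → ℝ) (i : Fin 2) : ℝ :=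
  inner ℝ (normal τ i true) (arcPoint τ i (τ i))

/-- The configuration of `C(τ₁, τ₂)`: the clasp curves, cut off at the bounding planes, so with
straight ends of length `cᵢ - bendLevel τ i`. -/
def claspConfig (τ c : Fin 2 → ℝ) (i : Fin 2) (t : I) : E3 :=
  arcPoint τ i ((2 * (t : ℝ) - 1) * (τ i + (c i - bendLevel τ i)))

end Clasp

end

/-!
Call a segment between `α₁(u₁)` and `α₂(u₂)` with `|u₁| / τ₁ + |u₂| / τ₂ = 1` a strut. Two struts
end at each interior point of the curved part of an arc; they are mirror images in the plane of
that arc, and the unit vectors along them, pointing towards the arc, add up to a negative multiple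
of the curvature vector there. Positive stresses on the struts therefore balance the curvature
forces of the arcs, and the matching of the two arcs along the struts singles out the weights
`1 / τᵢ`: the weighted first variation of length in the direction `ξ` is an integral, with positive
weights, of the rates at which `ξ` changes the lengths of the struts. Strictness comes from the
total `M` of these weights, which is found by testing with a dilation. If the weighted length
decreases at unit rate, some strut shrinks at a rate of at least `1 / M`, and by Danskin's theorem
so does the thickness.

No two points of different arcs are closer than `1`: for a fixed point of the first arc, the
distance to a point running along half of the second arc decreases up to the end of the strut and
increases from there on.
-/

open MeasureTheory Set Filter Topology Interval

noncomputable section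

namespace Clasp

section Velocity

variable {E : Type*} [NormedAddCommGroup E]

theorem exists_monotone_partition_norm_sub_le {T : ℝ → E} (hT : Continuous T) {η : ℝ}
    (hη : 0 < η) :
    ∃ (u : ℕ → I) (n : ℕ), u 0 = 0 ∧ u n = 1 ∧ Monotone u ∧
      ∀ k, ∃ y, ∀ x : I, x ∈ Icc (u k) (u (k + 1)) → ‖T x - T y‖ ≤ η := by
  obtain ⟨u, hu0, hu, ⟨n, hn⟩, hcover⟩ := exists_monotone_Icc_subset_open_cover_unitInterval
    (c := fun y : I => {x : I | ‖T x - T y‖ < η})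
    (fun y => isOpen_lt (by fun_prop) continuous_const)
    (fun x _ => mem_iUnion.2 ⟨x, by simpa using hη⟩)
  refine ⟨u, n, hu0, hn n le_rfl, hu, fun k => ?_⟩
  obtain ⟨y, hy⟩ := hcover k
  exact ⟨y, fun x hx => (hy hx).le⟩

variable [NormedSpace ℝ E]

/-- The curve `γ` is absolutely continuous on `[0, 1]` with integrable velocity `g`. As `γ` need
not be differentiable anywhere in particular, this is expressed through the fundamental theorem of
calculus. -/
structure HasVelocity (γ g : ℝ → E) : Prop where
  integrable : IntervalIntegrable g volume 0 1
  sub_eq_integral : ∀ s t : I, γ t - γ s = ∫ x in s..t, g x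

theorem HasVelocity.intervalIntegrable {γ g : ℝ → E} (h : HasVelocity γ g) (s t : I) :
    IntervalIntegrable g volume s t :=
  h.integrable.mono_set <| by rw [uIcc_of_le zero_le_one]; exact uIcc_subset_Icc s.2 t.2

theorem HasVelocity.dist_le {γ g : ℝ → E} (h : HasVelocity γ g) {s t : I} (hst : s ≤ t) :
    dist (γ s) (γ t) ≤ ∫ x in s..t, ‖g x‖ := by
  rw [dist_comm, dist_eq_norm, h.sub_eq_integral]
  exact intervalIntegral.norm_integral_le_integral_norm hst

theorem HasVelocity.add_smul [CompleteSpace E] {γ g f : ℝ → E} (h : HasVelocity γ g)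
    (hf : ContDiff ℝ 1 f) (r : ℝ) :
    HasVelocity (fun t => γ t + r • f t) (fun t => g t + r • deriv f t) where
  integrable := h.integrable.add
    (((hf.continuous_deriv le_rfl).intervalIntegrable 0 1).smul r)
  sub_eq_integral s t := by
    have hf' : IntervalIntegrable (deriv f) volume s t :=
      (hf.continuous_deriv le_rfl).intervalIntegrable s t
    have hrf' : IntervalIntegrable (fun x => r • deriv f x) volume s t := hf'.smul r
    rw [intervalIntegral.integral_add (h.intervalIntegrable s t) hrf',
      ← h.sub_eq_integral, intervalIntegral.integral_smul,
      intervalIntegral.integral_deriv_eq_sub (fun x _ => hf.differentiable one_ne_zero x) hf']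
    module

theorem HasVelocity.eVariationOn_le {γ g : ℝ → E} (h : HasVelocity γ g) :
    eVariationOn (fun t : I => γ t) univ ≤ ENNReal.ofReal (∫ x in (0 : ℝ)..1, ‖g x‖) := by
  refine iSup_le fun ⟨n, u, hu, _⟩ => ?_
  have hstep (k : ℕ) : edist (γ (u (k + 1))) (γ (u k)) ≤
      ENNReal.ofReal (∫ x in (u k : ℝ)..u (k + 1), ‖g x‖) := by
    rw [edist_comm, edist_dist]
    exact ENNReal.ofReal_le_ofReal (h.dist_le (hu k.le_succ))
  calc ∑ k ∈ Finset.range n, edist (γ (u (k + 1))) (γ (u k))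
      ≤ ∑ k ∈ Finset.range n, ENNReal.ofReal (∫ x in (u k : ℝ)..u (k + 1), ‖g x‖) :=
        Finset.sum_le_sum fun k _ => hstep k
    _ = ENNReal.ofReal (∫ x in (u 0 : ℝ)..u n, ‖g x‖) := by
        rw [← ENNReal.ofReal_sum_of_nonneg fun k _ =>
            intervalIntegral.integral_nonneg (hu k.le_succ) fun _ _ => norm_nonneg _,
          intervalIntegral.sum_integral_adjacent_intervals (a := fun k => (u k : ℝ))
            fun k _ => (h.intervalIntegrable (u k) (u (k + 1))).norm]
    _ ≤ ENNReal.ofReal (∫ x in (0 : ℝ)..1, ‖g x‖) := by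
        refine ENNReal.ofReal_le_ofReal ?_
        exact intervalIntegral.integral_mono_interval (u 0).2.1 (hu n.zero_le) (u n).2.2
          (Eventually.of_forall fun _ => norm_nonneg _) h.integrable.norm

theorem HasVelocity.eVariationOn_ne_top {γ g : ℝ → E} (h : HasVelocity γ g) :
    eVariationOn (fun t : I => γ t) univ ≠ ⊤ :=
  ne_top_of_le_ne_top ENNReal.ofReal_ne_top h.eVariationOn_le

end Velocity

section Length

variable {E : Type*} [NormedAddCommGroup E] [InnerProductSpace ℝ E]

theorem intervalIntegrable_inner {T g : ℝ → E} {a b : ℝ} (hT : Continuous T)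
    (hg : IntervalIntegrable g volume a b) :
    IntervalIntegrable (fun x => inner ℝ (T x) (g x)) volume a b := by
  obtain ⟨C, hC⟩ := (isCompact_uIcc (a := a) (b := b)).exists_bound_of_continuousOn
    hT.continuousOn
  refine (hg.norm.const_mul C).mono_fun'
    (hT.aestronglyMeasurable.inner hg.aestronglyMeasurable_restrict_uIoc) ?_
  refine (ae_restrict_iff' measurableSet_uIoc).2 (Eventually.of_forall fun x hx => ?_)
  exact (norm_inner_le_norm _ _).trans
    (mul_le_mul_of_nonneg_right (hC x (uIoc_subset_uIcc hx)) (norm_nonneg _))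

theorem HasVelocity.integral_inner_le_dist [CompleteSpace E] {γ g T : ℝ → E}
    (h : HasVelocity γ g) (hT : Continuous T) {s t : I} (hst : s ≤ t) {e : E} (he : ‖e‖ ≤ 1)
    {η : ℝ} (hTe : ∀ x : I, x ∈ Icc s t → ‖T x - e‖ ≤ η) :
    ∫ x in s..t, inner ℝ (T x) (g x) ≤
      dist (γ (t : ℝ)) (γ (s : ℝ)) + η * ∫ x in s..t, ‖g x‖ := by
  have hg := h.intervalIntegrable s t
  have hinner {u : ℝ → E} (hu : Continuous u) := intervalIntegrable_inner hu hg
  have hconst : ∫ x in s..t, inner ℝ e (g x) ≤ dist (γ (t : ℝ)) (γ (s : ℝ)) := by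
    calc ∫ x in s..t, inner ℝ e (g x) = inner ℝ e (γ t - γ s) := by
          rw [h.sub_eq_integral]
          exact (innerSL ℝ e).intervalIntegral_comp_comm hg
      _ ≤ ‖e‖ * ‖γ t - γ s‖ := real_inner_le_norm _ _
      _ ≤ dist (γ (t : ℝ)) (γ (s : ℝ)) := by
          rw [dist_eq_norm]; exact mul_le_of_le_one_left (norm_nonneg _) he
  have herror : ∫ x in s..t, inner ℝ (T x - e) (g x) ≤ η * ∫ x in s..t, ‖g x‖ := by
    rw [← intervalIntegral.integral_const_mul]
    refine intervalIntegral.integral_mono_on hst (hinner (hT.sub continuous_const))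
      (hg.norm.const_mul _) fun x hx => (real_inner_le_norm _ _).trans ?_
    exact mul_le_mul_of_nonneg_right
      (hTe ⟨x, s.2.1.trans hx.1, hx.2.trans t.2.2⟩ hx) (norm_nonneg _)
  simp only [inner_sub_left] at herror
  rw [intervalIntegral.integral_sub (hinner hT) (hinner continuous_const)] at herror
  linarith

theorem HasVelocity.integral_inner_le_eVariationOn [CompleteSpace E] {γ g T : ℝ → E}
    (h : HasVelocity γ g) (hT : Continuous T) (hT1 : ∀ x, ‖T x‖ ≤ 1) :
    ∫ x in (0 : ℝ)..1, inner ℝ (T x) (g x) ≤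
      (eVariationOn (fun t : I => γ t) univ).toReal := by
  set V := (eVariationOn (fun t : I => γ t) univ).toReal
  set J := ∫ x in (0 : ℝ)..1, ‖g x‖
  suffices happrox : ∀ η > 0, ∫ x in (0 : ℝ)..1, inner ℝ (T x) (g x) ≤ V + η * J by
    have hlim : Tendsto (fun η => V + η * J) (𝓝[>] 0) (𝓝 V) :=
      (Continuous.tendsto' (by fun_prop) 0 V (by simp)).mono_left nhdsWithin_le_nhds
    exact ge_of_tendsto hlim (eventually_mem_nhdsWithin.mono happrox)
  intro η hη
  obtain ⟨u, n, hu0, hun, hu, hTu⟩ := exists_monotone_partition_norm_sub_le hT hη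
  have hsum {p : ℝ → ℝ} (hp : ∀ s t : I, IntervalIntegrable p volume s t) :
      ∑ k ∈ Finset.range n, ∫ x in (u k : ℝ)..u (k + 1), p x = ∫ x in (0 : ℝ)..1, p x := by
    rw [intervalIntegral.sum_integral_adjacent_intervals (a := fun k => (u k : ℝ))
      fun k _ => hp (u k) (u (k + 1)), hu0, hun, Icc.coe_zero, Icc.coe_one]
  have hstep (k : ℕ) : ∫ x in (u k : ℝ)..u (k + 1), inner ℝ (T x) (g x) ≤
      dist (γ (u (k + 1))) (γ (u k)) + η * ∫ x in (u k : ℝ)..u (k + 1), ‖g x‖ := by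
    obtain ⟨y, hy⟩ := hTu k
    exact h.integral_inner_le_dist hT (hu k.le_succ) (hT1 y) hy
  have hpolygon : ∑ k ∈ Finset.range n, dist (γ (u (k + 1))) (γ (u k)) ≤ V := by
    rw [← ENNReal.ofReal_le_iff_le_toReal h.eVariationOn_ne_top,
      ENNReal.ofReal_sum_of_nonneg fun _ _ => dist_nonneg]
    simp only [← edist_dist]
    exact eVariationOn.sum_le (f := fun t : I => γ t) hu fun _ => mem_univ _
  calc ∫ x in (0 : ℝ)..1, inner ℝ (T x) (g x)
      = ∑ k ∈ Finset.range n, ∫ x in (u k : ℝ)..u (k + 1), inner ℝ (T x) (g x) :=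
        (hsum fun s t => intervalIntegrable_inner hT (h.intervalIntegrable s t)).symm
    _ ≤ ∑ k ∈ Finset.range n, (dist (γ (u (k + 1))) (γ (u k)) +
          η * ∫ x in (u k : ℝ)..u (k + 1), ‖g x‖) := Finset.sum_le_sum fun k _ => hstep k
    _ = ∑ k ∈ Finset.range n, dist (γ (u (k + 1))) (γ (u k)) + η * J := by
        rw [Finset.sum_add_distrib, ← Finset.mul_sum,
          hsum fun s t => (h.intervalIntegrable s t).norm]
    _ ≤ V + η * J := by gcongr

theorem hasDerivAt_norm_smul_add_smul {T w : E} (hT : ‖T‖ = 1) {v : ℝ} (hv : 0 < v) :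
    HasDerivAt (fun r : ℝ => ‖v • T + r • w‖) (inner ℝ T w) 0 := by
  have hnorm : ‖v • T‖ = v := by rw [norm_smul, hT, Real.norm_of_nonneg hv.le, mul_one]
  have hline : HasDerivAt (fun r : ℝ => v • T + r • w) w 0 := by
    simpa using ((hasDerivAt_id (0 : ℝ)).smul_const w).const_add (v • T)
  have hsqrt := hline.norm_sq.sqrt (by simp [hnorm, hv.ne'])
  simp only [Real.sqrt_sq (norm_nonneg _), zero_smul, add_zero, hnorm,
    real_inner_smul_left] at hsqrt
  exact hsqrt.congr_deriv (by rw [Real.sqrt_sq hv.le]; field_simp)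

theorem hasDerivAt_integral_norm_add_smul {g T w : ℝ → E} {a b : ℝ}
    (hg : IntervalIntegrable g volume a b) (hT : Continuous T) (hT1 : ∀ x, ‖T x‖ = 1)
    (hgT : ∀ᵐ x, x ∈ Ι a b → ∃ v > (0 : ℝ), g x = v • T x) (hw : Continuous w) :
    HasDerivAt (fun r : ℝ => ∫ x in a..b, ‖g x + r • w x‖)
      (∫ x in a..b, inner ℝ (T x) (w x)) 0 := by
  have hwi : IntervalIntegrable w volume a b := hw.intervalIntegrable a b
  refine (intervalIntegral.hasDerivAt_integral_of_dominated_loc_of_lip (s := univ)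
    (bound := fun x => ‖w x‖) (F' := fun x => inner ℝ (T x) (w x)) univ_mem ?_ ?_
    (hT.inner hw).aestronglyMeasurable ?_ hwi.norm ?_).2
  · exact Eventually.of_forall fun r =>
      (hg.add (hwi.smul r)).norm.aestronglyMeasurable_restrict_uIoc
  · simpa using hg.norm
  · refine Eventually.of_forall fun x _ => LipschitzOnWith.of_dist_le_mul fun r _ s _ => ?_
    rw [Real.dist_eq, Real.coe_nnabs, abs_norm]
    refine (abs_norm_sub_norm_le _ _).trans_eq ?_
    rw [add_sub_add_left_eq_sub, ← sub_smul, norm_smul, mul_comm, Real.dist_eq, Real.norm_eq_abs]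
  · filter_upwards [hgT] with x hx hxab
    obtain ⟨v, hv, hgx⟩ := hx hxab
    rw [hgx]
    exact hasDerivAt_norm_smul_add_smul (hT1 x) hv

theorem hasDerivAt_zero_of_affine_le_of_le {φ ψ : ℝ → ℝ} {m : ℝ} (hψ : HasDerivAt ψ m 0)
    (hlow : ∀ r, ψ 0 + r * m ≤ φ r) (hup : ∀ r, φ r ≤ ψ r) : HasDerivAt φ m 0 := by
  have h0 : φ 0 = ψ 0 := (hup 0).antisymm (by simpa using hlow 0)
  rw [hasDerivAt_iff_isLittleO] at hψ ⊢
  refine (Asymptotics.IsBigO.of_norm_le fun r => ?_).trans_isLittleO hψ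
  simp only [h0, sub_zero, smul_eq_mul, Real.norm_eq_abs]
  have hlow := hlow r
  have hup := hup r
  rw [abs_of_nonneg (by linarith)]
  linarith

/-- The speed is not assumed to be bounded away from `0` or `∞`: testing the velocity against `T`
bounds the length from below by an affine function of `r`, integrating the speed bounds it from
above, and the two bounds are tangent at `r = 0`. -/
theorem HasVelocity.hasDerivAt_toReal_eVariationOn [CompleteSpace E] {γ g T f : ℝ → E}
    (h : HasVelocity γ g) (hT : Continuous T) (hT1 : ∀ x, ‖T x‖ = 1)
    (hgT : ∀ᵐ x, x ∈ Ι (0 : ℝ) 1 → ∃ v > (0 : ℝ), g x = v • T x) (hf : ContDiff ℝ 1 f) :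
    HasDerivAt (fun r : ℝ => (eVariationOn (fun t : I => γ t + r • f t) univ).toReal)
      (∫ x in (0 : ℝ)..1, inner ℝ (T x) (deriv f x)) 0 := by
  have hf' := hf.continuous_deriv le_rfl
  have hspeed : ∫ x in (0 : ℝ)..1, ‖g x‖ = ∫ x in (0 : ℝ)..1, inner ℝ (T x) (g x) := by
    refine intervalIntegral.integral_congr_ae ?_
    filter_upwards [hgT] with x hx hx01
    obtain ⟨v, hv, hgx⟩ := hx hx01
    rw [hgx, norm_smul, real_inner_smul_right, real_inner_self_eq_norm_sq, hT1,
      Real.norm_of_nonneg hv.le, one_pow]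
  refine hasDerivAt_zero_of_affine_le_of_le
    (hasDerivAt_integral_norm_add_smul h.integrable hT hT1 hgT hf') (fun r => ?_) fun r => ?_
  · refine le_trans (le_of_eq ?_) <|
      (h.add_smul hf r).integral_inner_le_eVariationOn hT fun x => (hT1 x).le
    simp only [zero_smul, add_zero, hspeed, inner_add_right, real_inner_smul_right]
    rw [intervalIntegral.integral_add (intervalIntegrable_inner hT h.integrable)
        ((intervalIntegrable_inner hT (hf'.intervalIntegrable 0 1)).const_mul r),
      intervalIntegral.integral_const_mul]
  · exact ENNReal.toReal_le_of_le_ofReal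
      (intervalIntegral.integral_nonneg zero_le_one fun _ _ => norm_nonneg _)
      (h.add_smul hf r).eVariationOn_le

end Length

section Danskin

theorem abs_ciInf_sub_ciInf_le {Q : Type*} [Nonempty Q] {f g : Q → ℝ} {ε : ℝ}
    (hg : BddBelow (range g)) (h : ∀ q, |f q - g q| ≤ ε) : |(⨅ q, f q) - ⨅ q, g q| ≤ ε := by
  have hf : BddBelow (range f) := by
    obtain ⟨m, hm⟩ := hg
    refine ⟨m - ε, forall_mem_range.2 fun q => ?_⟩
    linarith [hm (mem_range_self q), (abs_le.1 (h q)).1]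
  refine abs_sub_le_iff.2 ⟨sub_le_comm.1 (le_ciInf fun q => ?_),
    sub_le_comm.1 (le_ciInf fun q => ?_)⟩
  · linarith [ciInf_le hf q, (abs_le.1 (h q)).2]
  · linarith [ciInf_le hg q, (abs_le.1 (h q)).1]

theorem concaveOn_iInf_affine {Q : Type*} [Nonempty Q] {a b : Q → ℝ}
    (hbdd : ∀ r : ℝ, BddBelow (range fun q => a q + r * b q)) :
    ConcaveOn ℝ univ fun r : ℝ => ⨅ q, (a q + r * b q) := by
  refine ⟨convex_univ, fun x _ y _ s t hs ht hst => le_ciInf fun q => ?_⟩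
  calc s • (⨅ q, (a q + x * b q)) + t • ⨅ q, (a q + y * b q)
      ≤ s * (a q + x * b q) + t * (a q + y * b q) :=
        add_le_add (mul_le_mul_of_nonneg_left (ciInf_le (hbdd x) q) hs)
          (mul_le_mul_of_nonneg_left (ciInf_le (hbdd y) q) ht)
    _ = a q + (s • x + t • y) * b q := by
        rw [smul_eq_mul, smul_eq_mul]; linear_combination a q * hst

variable {Q : Type*} [TopologicalSpace Q] [CompactSpace Q] [Nonempty Q]

theorem exists_hasDerivWithinAt_iInf_affine {a b : Q → ℝ} (ha : Continuous a)
    (hb : Continuous b) :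
    ∃ d : ℝ, HasDerivWithinAt (fun r : ℝ => ⨅ q, (a q + r * b q)) d (Ici 0) 0 ∧
      ∀ q, a q = ⨅ q, a q → d ≤ b q := by
  have hbdd (r : ℝ) : BddBelow (range fun q => a q + r * b q) :=
    (isCompact_range (by fun_prop)).bddBelow
  have hd := ((concaveOn_iInf_affine hbdd).neg.hasDerivWithinAt_rightDeriv_of_mem_interior
    (x := 0) (by simp)).neg
  simp only [Pi.neg_def, neg_neg] at hd
  refine ⟨_, hasDerivWithinAt_Ioi_iff_Ici.1 hd, fun q hq => ?_⟩
  refine le_of_tendsto ((hasDerivWithinAt_iff_tendsto_slope' (by simp)).1 hd) ?_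
  filter_upwards [self_mem_nhdsWithin] with r (hr : 0 < r)
  simp only [slope_def_field, sub_zero, zero_mul, add_zero, ← hq]
  rw [div_le_iff₀ hr]
  linarith [ciInf_le (hbdd r) q]

/-- Danskin's theorem. -/
theorem exists_hasDerivWithinAt_iInf {a b : Q → ℝ} (ha : Continuous a) (hb : Continuous b)
    {φ : Q → ℝ → ℝ} {C : ℝ} (hφ : ∀ q r, |φ q r - (a q + r * b q)| ≤ C * r ^ 2) :
    ∃ d : ℝ, HasDerivWithinAt (fun r => ⨅ q, φ q r) d (Ici 0) 0 ∧
      ∀ q, a q = ⨅ q, a q → d ≤ b q := by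
  obtain ⟨d, hd, hdb⟩ := exists_hasDerivWithinAt_iInf_affine ha hb
  refine ⟨d, ?_, hdb⟩
  have hremainder (r : ℝ) : |(⨅ q, φ q r) - ⨅ q, (a q + r * b q)| ≤ C * r ^ 2 :=
    abs_ciInf_sub_ciInf_le (isCompact_range (by fun_prop)).bddBelow fun q => hφ q r
  have hremainder0 : (⨅ q, φ q 0) - ⨅ q, (a q + 0 * b q) = 0 :=
    abs_nonpos_iff.1 (by simpa using hremainder 0)
  have hremainder' :
      HasDerivWithinAt (fun r => (⨅ q, φ q r) - ⨅ q, (a q + r * b q)) 0 (Ici 0) 0 := by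
    rw [hasDerivWithinAt_iff_isLittleO]
    simp only [hremainder0, sub_zero, smul_zero]
    refine (Asymptotics.isBigO_of_le' (c := C) _ fun r => ?_).trans_isLittleO <|
      (Asymptotics.isLittleO_pow_id one_lt_two).mono nhdsWithin_le_nhds
    simpa using hremainder r
  simpa only [Pi.add_def, sub_add_cancel, zero_add] using hremainder'.add hd

end Danskin

section OneSidedVariation

theorem abs_norm_add_smul_sub_le {E : Type*} [NormedAddCommGroup E] [InnerProductSpace ℝ E]
    {A : E} (hA : A ≠ 0) (B : E) (r : ℝ) :
    |‖A + r • B‖ - (‖A‖ + r * (inner ℝ A B / ‖A‖))| ≤ ‖B‖ ^ 2 / (2 * ‖A‖) * r ^ 2 := by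
  have hA0 : 0 < ‖A‖ := norm_pos_iff.2 hA
  have hsq : ‖A + r • B‖ ^ 2 = ‖A‖ ^ 2 + 2 * (r * inner ℝ A B) + r ^ 2 * ‖B‖ ^ 2 := by
    rw [norm_add_sq_real, inner_smul_right, norm_smul, mul_pow, Real.norm_eq_abs, sq_abs]
  have hcauchy : ‖A‖ ^ 2 + r * inner ℝ A B ≤ ‖A + r • B‖ * ‖A‖ := by
    have := real_inner_le_norm (A + r • B) A
    rwa [inner_add_left, real_inner_self_eq_norm_sq, real_inner_smul_left,
      real_inner_comm A B] at this
  have hamgm : ‖A + r • B‖ * ‖A‖ ≤ ‖A‖ ^ 2 + r * inner ℝ A B + r ^ 2 * ‖B‖ ^ 2 / 2 := by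
    linarith [two_mul_le_add_sq ‖A + r • B‖ ‖A‖]
  rw [abs_of_nonneg (sub_nonneg.2 ?_), sub_le_iff_le_add, ← mul_le_mul_iff_left₀ hA0]
  · refine hamgm.trans_eq ?_
    field_simp
    ring
  · rw [← mul_le_mul_iff_left₀ hA0]
    refine le_of_eq_of_le ?_ hcauchy
    field_simp

theorem exists_hasDerivWithinAt_iInf_norm_add_smul {Q E : Type*} [TopologicalSpace Q]
    [CompactSpace Q] [Nonempty Q] [NormedAddCommGroup E] [InnerProductSpace ℝ E] {A B : Q → E}
    (hA : Continuous A) (hA0 : ∀ q, A q ≠ 0) (hB : Continuous B) :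
    ∃ d, HasDerivWithinAt (fun r : ℝ => ⨅ q, ‖A q + r • B q‖) d (Ici 0) 0 ∧
      ∀ q, ‖A q‖ = ⨅ q, ‖A q‖ → d ≤ inner ℝ (A q) (B q) / ‖A q‖ := by
  obtain ⟨C, hC⟩ := isCompact_univ.exists_bound_of_continuousOn
    (f := fun q => ‖B q‖ ^ 2 / (2 * ‖A q‖))
    (Continuous.div (by fun_prop) (by fun_prop) fun q => by simp [hA0 q]).continuousOn
  exact exists_hasDerivWithinAt_iInf hA.norm
    ((hA.inner hB).div hA.norm fun q => norm_ne_zero_iff.2 (hA0 q)) fun q r =>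
      (abs_norm_add_smul_sub_le (hA0 q) (B q) r).trans <|
        mul_le_mul_of_nonneg_right ((le_abs_self _).trans (hC q (mem_univ q))) (sq_nonneg r)

variable {ι : Type}

theorem gThi_eq_iInf (L : ι → I → E3) :
    gThi L = ⨅ q : {p : ι × ι // p.1 ≠ p.2} × I × I,
      dist (L q.1.1.1 q.2.1) (L q.1.1.2 q.2.2) := by
  refine congrArg sInf (Set.ext fun d => ⟨?_, ?_⟩)
  · rintro ⟨i, j, hij, s, t, rfl⟩
    exact ⟨⟨⟨(i, j), hij⟩, s, t⟩, rfl⟩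
  · rintro ⟨⟨⟨⟨i, j⟩, hij⟩, s, t⟩, rfl⟩
    exact ⟨i, j, hij, s, t, rfl⟩

theorem gThi_eq_of_forall_le_dist {L : ι → I → E3} {d : ℝ}
    (hle : ∀ i j, i ≠ j → ∀ s t, d ≤ dist (L i s) (L j t)) {i j : ι} (hij : i ≠ j) {s t : I}
    (hst : dist (L i s) (L j t) = d) : gThi L = d := by
  refine IsLeast.csInf_eq ⟨⟨i, j, hij, s, t, hst.symm⟩, ?_⟩
  rintro _ ⟨i, j, hij, s, t, rfl⟩
  exact hle i j hij s t

theorem exists_hasOneSidedVariation_gThi [Finite ι] [Nontrivial ι] {L : ι → I → E3}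
    (hL : ∀ i, Continuous (L i)) (hdisj : ∀ i j, i ≠ j → ∀ s t, L i s ≠ L j t)
    (ξ : ι → C(I, E3)) :
    ∃ d, HasOneSidedVariation gThi L ξ d ∧
      ∀ i j, i ≠ j → ∀ s t, dist (L i s) (L j t) = gThi L →
        d ≤ inner ℝ (L i s - L j t) (ξ i s - ξ j t) / gThi L := by
  let _ : TopologicalSpace ι := ⊥
  have _ : DiscreteTopology ι := ⟨rfl⟩
  let Q := {p : ι × ι // p.1 ≠ p.2} × I × I
  have _ : Nonempty {p : ι × ι // p.1 ≠ p.2} :=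
    let ⟨i, j, hij⟩ := exists_pair_ne ι
    ⟨⟨(i, j), hij⟩⟩
  have hsub {M : ι → I → E3} (hM : ∀ i, Continuous (M i)) :
      Continuous fun q : Q => M q.1.1.1 q.2.1 - M q.1.1.2 q.2.2 :=
    continuous_prod_of_discrete_left.2 fun p =>
      ((hM p.1.1).comp continuous_fst).sub ((hM p.1.2).comp continuous_snd)
  obtain ⟨d, hd, hdb⟩ := exists_hasDerivWithinAt_iInf_norm_add_smul (hsub hL)
    (fun q => sub_ne_zero.2 (hdisj _ _ q.1.2 _ _)) (hsub fun i => (ξ i).continuous)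
  refine ⟨d, ?_, fun i j hij s t hst => ?_⟩
  · have hvary (r : ℝ) : gThi (vary L ξ r) = ⨅ q : Q, ‖L q.1.1.1 q.2.1 - L q.1.1.2 q.2.2 +
        r • (ξ q.1.1.1 q.2.1 - ξ q.1.1.2 q.2.2)‖ := by
      rw [gThi_eq_iInf]
      refine iInf_congr fun q => ?_
      rw [dist_eq_norm]
      congr 1
      simp only [vary]
      module
    simpa only [HasOneSidedVariation, hvary] using hd
  · rw [← hst, dist_eq_norm]
    refine hdb (⟨(i, j), hij⟩, s, t) ?_
    simp only [← dist_eq_norm, hst, gThi_eq_iInf L]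
    rfl

theorem exists_hasOneSidedVariation_obstacleMin (τ c : Fin 2 → ℝ) {L : Fin 2 → I → E3}
    (hL : ∀ i, Continuous (L i)) (ξ : Fin 2 → C(I, E3)) :
    ∃ d, HasOneSidedVariation (obstacleMin (claspConstraints τ c)) L ξ d := by
  have hlevel {M : Fin 2 → I → E3} (hM : ∀ i, Continuous (M i)) :
      Continuous fun q : (Fin 2 × Bool) × Fin 2 × I =>
        inner ℝ (normal τ q.1.1 q.1.2) (M q.2.1 q.2.2) :=
    continuous_prod_of_discrete_left.2 fun k => continuous_prod_of_discrete_left.2 fun i =>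
      (continuous_const (y := normal τ k.1 k.2)).inner (𝕜 := ℝ) (hM i)
  have hc : Continuous fun q : (Fin 2 × Bool) × Fin 2 × I => c q.1.1 :=
    continuous_prod_of_discrete_left.2 fun k => continuous_const (y := c k.1)
  obtain ⟨d, hd, -⟩ := exists_hasDerivWithinAt_iInf_affine (hc.sub (hlevel hL))
    (hlevel fun i => (ξ i).continuous).neg
  refine ⟨d, hd.congr_of_eventuallyEq (Eventually.of_forall fun r => ?_) ?_⟩ <;>
  · refine iInf_congr fun q => ?_
    simp only [claspConstraints, vary, inner_add_right, inner_smul_right, Pi.sub_apply,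
      Pi.neg_apply]
    ring

end OneSidedVariation

section Profile

variable {τ : Fin 2 → ℝ}

theorem abs_lt_of_mem_Ioo_zero {a u : ℝ} (hu : u ∈ Ioo 0 a) : |u| < a := by
  rw [abs_of_pos hu.1]
  exact hu.2

theorem abs_le_of_mem_Icc_zero {a u : ℝ} (hu : u ∈ Icc 0 a) : |u| ≤ a := by
  rw [abs_of_nonneg hu.1]
  exact hu.2

theorem partner_neg (τ : Fin 2 → ℝ) (i : Fin 2) (u : ℝ) : partner τ i (-u) = partner τ i u := by
  simp [partner]

theorem partner_zero (τ : Fin 2 → ℝ) (i : Fin 2) : partner τ i 0 = τ i.rev := by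
  simp [partner]

theorem partner_self {i : Fin 2} (hi : 0 < τ i) : partner τ i (τ i) = 0 := by
  simp [partner, abs_of_pos hi, hi.ne']

theorem partner_le_partner (hτ : ∀ i, 0 < τ i ∧ τ i ≤ 1) (i : Fin 2) {u v : ℝ} (h : |u| ≤ |v|) :
    partner τ i v ≤ partner τ i u := by
  have hrev := (hτ i.rev).1
  have hi := (hτ i).1
  unfold partner
  gcongr

theorem partner_lt_partner (hτ : ∀ i, 0 < τ i ∧ τ i ≤ 1) (i : Fin 2) {u v : ℝ} (h : |u| < |v|) :
    partner τ i v < partner τ i u := by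
  have hrev := (hτ i.rev).1
  have hi := (hτ i).1
  unfold partner
  gcongr

theorem partner_mem_Icc (hτ : ∀ i, 0 < τ i ∧ τ i ≤ 1) (i : Fin 2) {u : ℝ} (hu : |u| ≤ τ i) :
    partner τ i u ∈ Icc 0 (τ i.rev) := by
  rw [← partner_self (hτ i).1, ← partner_zero τ i]
  exact ⟨partner_le_partner hτ i (by rwa [abs_of_pos (hτ i).1]),
    partner_le_partner hτ i (by simp)⟩

theorem partner_mem_Ioo (hτ : ∀ i, 0 < τ i ∧ τ i ≤ 1) (i : Fin 2) {u : ℝ}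
    (hu : u ∈ Ioo 0 (τ i)) : partner τ i u ∈ Ioo 0 (τ i.rev) := by
  rw [← partner_self (hτ i).1, ← partner_zero τ i]
  refine ⟨partner_lt_partner hτ i ?_, partner_lt_partner hτ i (by simpa using hu.1.ne')⟩
  simpa [abs_of_pos (hτ i).1] using abs_lt_of_mem_Ioo_zero hu

theorem abs_partner_le (hτ : ∀ i, 0 < τ i ∧ τ i ≤ 1) (i : Fin 2) {u : ℝ} (hu : |u| ≤ τ i) :
    |partner τ i u| ≤ τ i.rev :=
  abs_le_of_mem_Icc_zero (partner_mem_Icc hτ i hu)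

theorem continuous_partner (τ : Fin 2 → ℝ) (i : Fin 2) : Continuous (partner τ i) := by
  unfold partner
  fun_prop

theorem one_sub_sq_nonneg (hτ : ∀ i, 0 < τ i ∧ τ i ≤ 1) (i : Fin 2) {u : ℝ} (hu : |u| ≤ τ i) :
    0 ≤ 1 - u ^ 2 :=
  sub_nonneg.2 ((sq_le_one_iff_abs_le_one u).2 (hu.trans (hτ i).2))

theorem one_sub_sq_pos (hτ : ∀ i, 0 < τ i ∧ τ i ≤ 1) (i : Fin 2) {u : ℝ} (hu : |u| < τ i) :
    0 < 1 - u ^ 2 :=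
  sub_pos.2 ((sq_lt_one_iff_abs_lt_one u).2 (hu.trans_le (hτ i).2))

theorem one_sub_partner_sq_nonneg (hτ : ∀ i, 0 < τ i ∧ τ i ≤ 1) (i : Fin 2) {u : ℝ}
    (hu : |u| ≤ τ i) : 0 ≤ 1 - partner τ i u ^ 2 :=
  one_sub_sq_nonneg hτ i.rev (abs_partner_le hτ i hu)

theorem one_sub_sq_mul_partner_sq_pos (hτ : ∀ i, 0 < τ i ∧ τ i ≤ 1) (i : Fin 2) {u : ℝ}
    (hu : |u| ≤ τ i) : 0 < 1 - u ^ 2 * partner τ i u ^ 2 := by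
  have hpartner0 := (partner_mem_Icc hτ i hu).1
  have hpartner : partner τ i u ≤ 1 - |u| := by
    have hratio : |u| ≤ |u| / τ i := le_div_self (abs_nonneg _) (hτ i).1 (hτ i).2
    have hratio1 : |u| / τ i ≤ 1 := (div_le_one (hτ i).1).2 hu
    calc τ i.rev * (1 - |u| / τ i) ≤ 1 * (1 - |u| / τ i) :=
          mul_le_mul_of_nonneg_right (hτ i.rev).2 (sub_nonneg.2 hratio1)
      _ ≤ 1 - |u| := by linarith
  have hprod : |u| * partner τ i u < 1 := by
    nlinarith [mul_le_mul_of_nonneg_left hpartner (abs_nonneg u), sq_nonneg (|u| - 1 / 2)]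
  rw [← sq_abs u, ← mul_pow, sub_pos]
  exact pow_lt_one₀ (mul_nonneg (abs_nonneg u) hpartner0) hprod two_ne_zero

theorem claspX_neg (τ : Fin 2 → ℝ) (i : Fin 2) (u : ℝ) : claspX τ i (-u) = -claspX τ i u := by
  simp [claspX, partner_neg]

theorem claspX_zero (τ : Fin 2 → ℝ) (i : Fin 2) : claspX τ i 0 = 0 := by simp [claspX]

theorem claspX_self {i : Fin 2} (hi : 0 < τ i) : claspX τ i (τ i) = τ i := by
  simp [claspX, partner_self hi]

theorem claspX_nonneg (τ : Fin 2 → ℝ) (i : Fin 2) {u : ℝ} (hu : 0 ≤ u) : 0 ≤ claspX τ i u :=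
  mul_nonneg hu (Real.sqrt_nonneg _)

theorem claspX_pos (hτ : ∀ i, 0 < τ i ∧ τ i ≤ 1) (i : Fin 2) {u : ℝ} (hu : u ∈ Ioc 0 (τ i)) :
    0 < claspX τ i u := by
  have hu' : |u| ≤ τ i := abs_le_of_mem_Icc_zero (Ioc_subset_Icc_self hu)
  have hpartner : |partner τ i u| < τ i.rev := by
    rw [abs_of_nonneg (partner_mem_Icc hτ i hu').1, ← partner_zero τ i]
    exact partner_lt_partner hτ i (by simpa using hu.1.ne')
  exact mul_pos hu.1 (Real.sqrt_pos.2 (div_pos (one_sub_sq_pos hτ i.rev hpartner)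
    (one_sub_sq_mul_partner_sq_pos hτ i hu')))

theorem claspX_sq (hτ : ∀ i, 0 < τ i ∧ τ i ≤ 1) (i : Fin 2) {u : ℝ} (hu : |u| ≤ τ i) :
    claspX τ i u ^ 2 = u ^ 2 * (1 - partner τ i u ^ 2) / (1 - u ^ 2 * partner τ i u ^ 2) := by
  unfold claspX
  rw [mul_pow, Real.sq_sqrt (div_nonneg (one_sub_partner_sq_nonneg hτ i hu)
    (one_sub_sq_mul_partner_sq_pos hτ i hu).le), mul_div_assoc]

theorem one_sub_claspX_sq (hτ : ∀ i, 0 < τ i ∧ τ i ≤ 1) (i : Fin 2) {u : ℝ} (hu : |u| ≤ τ i) :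
    1 - claspX τ i u ^ 2 = (1 - u ^ 2) / (1 - u ^ 2 * partner τ i u ^ 2) := by
  rw [claspX_sq hτ i hu]
  have := (one_sub_sq_mul_partner_sq_pos hτ i hu).ne'
  field_simp
  ring

theorem continuousOn_claspX (hτ : ∀ i, 0 < τ i ∧ τ i ≤ 1) (i : Fin 2) :
    ContinuousOn (claspX τ i) (Icc (-τ i) (τ i)) := by
  have hp := continuous_partner τ i
  exact continuousOn_id.mul (ContinuousOn.sqrt (ContinuousOn.div (by fun_prop) (by fun_prop)
    fun u hu => (one_sub_sq_mul_partner_sq_pos hτ i (abs_le.2 hu)).ne'))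

/-- The derivative of `claspX` between the tip and the end of the curved part. -/
def slopeX (τ : Fin 2 → ℝ) (i : Fin 2) (u : ℝ) : ℝ :=
  (u * (1 - partner τ i u ^ 2) +
    partner τ i u * (τ i.rev / τ i) * u ^ 2 * (1 - u ^ 2)) /
      ((1 - u ^ 2 * partner τ i u ^ 2) ^ 2 * claspX τ i u)

theorem hasDerivAt_partner (τ : Fin 2 → ℝ) (i : Fin 2) {u : ℝ} (hu : 0 < u) :
    HasDerivAt (partner τ i) (-(τ i.rev / τ i)) u := by
  have hlinear : HasDerivAt (fun s : ℝ => τ i.rev * (1 - s / τ i)) (τ i.rev * (-(1 / τ i))) u :=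
    (((hasDerivAt_id u).div_const (τ i)).const_sub 1).const_mul _
  refine (hlinear.congr_of_eventuallyEq ?_).congr_deriv (by ring)
  filter_upwards [lt_mem_nhds hu] with s hs
  simp [partner, abs_of_pos hs]

theorem hasDerivAt_claspX (hτ : ∀ i, 0 < τ i ∧ τ i ≤ 1) (i : Fin 2) {u : ℝ}
    (hu : u ∈ Ioo 0 (τ i)) : HasDerivAt (claspX τ i) (slopeX τ i u) u := by
  have hu' : |u| ≤ τ i := (abs_lt_of_mem_Ioo_zero hu).le
  have hD := one_sub_sq_mul_partner_sq_pos hτ i hu'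
  have hx := claspX_pos hτ i ⟨hu.1, hu.2.le⟩
  have hp := hasDerivAt_partner τ i hu.1
  have hsq := claspX_sq hτ i hu'
  have hnum : HasDerivAt (fun s => s ^ 2 * (1 - partner τ i s ^ 2))
      (2 * u * (1 - partner τ i u ^ 2) + u ^ 2 * (2 * partner τ i u * (τ i.rev / τ i))) u :=
    ((hasDerivAt_pow 2 u).mul ((hp.pow 2).const_sub 1)).congr_deriv (by
      simp only [Pi.pow_apply]; push_cast; ring)
  have hden : HasDerivAt (fun s => 1 - s ^ 2 * partner τ i s ^ 2)
      (-(2 * u * partner τ i u ^ 2 - u ^ 2 * (2 * partner τ i u * (τ i.rev / τ i)))) u :=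
    (((hasDerivAt_pow 2 u).mul (hp.pow 2)).const_sub 1).congr_deriv (by
      simp only [Pi.pow_apply]; push_cast; ring)
  have hsqrt := (hnum.div hden hD.ne').sqrt (by
    simp only [Pi.div_apply]; rw [← hsq]; positivity)
  have hev : claspX τ i =ᶠ[𝓝 u] fun s =>
      √(s ^ 2 * (1 - partner τ i s ^ 2) / (1 - s ^ 2 * partner τ i s ^ 2)) := by
    filter_upwards [Ioo_mem_nhds hu.1 hu.2] with s hs
    rw [← claspX_sq hτ i (abs_lt_of_mem_Ioo_zero hs).le, Real.sqrt_sq (claspX_nonneg τ i hs.1.le)]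
  refine (hsqrt.congr_of_eventuallyEq hev).congr_deriv ?_
  simp only [Pi.div_apply]
  rw [← hsq, Real.sqrt_sq hx.le, slopeX]
  field_simp
  ring

theorem slopeX_pos (hτ : ∀ i, 0 < τ i ∧ τ i ≤ 1) (i : Fin 2) {u : ℝ} (hu : u ∈ Ioo 0 (τ i)) :
    0 < slopeX τ i u := by
  have hu' : |u| < τ i := abs_lt_of_mem_Ioo_zero hu
  have := hu.1
  have := one_sub_sq_mul_partner_sq_pos hτ i hu'.le
  have := claspX_pos hτ i ⟨hu.1, hu.2.le⟩
  have := (partner_mem_Ioo hτ i hu).1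
  have := one_sub_sq_pos hτ i hu'
  have := one_sub_partner_sq_nonneg hτ i hu'.le
  have := (hτ i.rev).1
  have := (hτ i).1
  unfold slopeX
  positivity

theorem continuousOn_slopeX (hτ : ∀ i, 0 < τ i ∧ τ i ≤ 1) (i : Fin 2) :
    ContinuousOn (slopeX τ i) (Ioo 0 (τ i)) := by
  have hp := (continuous_partner τ i).continuousOn (s := Ioo 0 (τ i))
  have hx : ContinuousOn (claspX τ i) (Ioo 0 (τ i)) :=
    (continuousOn_claspX hτ i).mono fun u hu => abs_le.1 (abs_lt_of_mem_Ioo_zero hu).le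
  unfold slopeX
  refine ContinuousOn.div (by fun_prop) (by fun_prop) fun u hu => ?_
  have := one_sub_sq_mul_partner_sq_pos hτ i (abs_lt_of_mem_Ioo_zero hu).le
  have := claspX_pos hτ i ⟨hu.1, hu.2.le⟩
  positivity

theorem monotoneOn_claspX (hτ : ∀ i, 0 < τ i ∧ τ i ≤ 1) (i : Fin 2) :
    MonotoneOn (claspX τ i) (Icc 0 (τ i)) := by
  refine monotoneOn_of_deriv_nonneg (convex_Icc _ _)
    ((continuousOn_claspX hτ i).mono fun u hu => abs_le.1 (abs_le_of_mem_Icc_zero hu)) ?_ ?_ <;>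
    rw [interior_Icc] <;> intro u hu
  · exact (hasDerivAt_claspX hτ i hu).differentiableAt.differentiableWithinAt
  · rw [(hasDerivAt_claspX hτ i hu).deriv]
    exact (slopeX_pos hτ i hu).le

/-- The speed of the curved part in the parameter `u`, for `0 < u < τ i`. -/
def curvedSpeed (τ : Fin 2 → ℝ) (i : Fin 2) (u : ℝ) : ℝ := slopeX τ i u / √(1 - u ^ 2)

theorem curvedSpeed_pos (hτ : ∀ i, 0 < τ i ∧ τ i ≤ 1) (i : Fin 2) {u : ℝ}
    (hu : u ∈ Ioo 0 (τ i)) : 0 < curvedSpeed τ i u :=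
  div_pos (slopeX_pos hτ i hu) (Real.sqrt_pos.2 (one_sub_sq_pos hτ i (abs_lt_of_mem_Ioo_zero hu)))

theorem sqrt_mul_curvedSpeed (hτ : ∀ i, 0 < τ i ∧ τ i ≤ 1) (i : Fin 2) {u : ℝ}
    (hu : u ∈ Ioo 0 (τ i)) : √(1 - u ^ 2) * curvedSpeed τ i u = slopeX τ i u :=
  mul_div_cancel₀ _ (Real.sqrt_pos.2 (one_sub_sq_pos hτ i (abs_lt_of_mem_Ioo_zero hu))).ne'

theorem continuousOn_curvedSpeed (hτ : ∀ i, 0 < τ i ∧ τ i ≤ 1) (i : Fin 2) :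
    ContinuousOn (curvedSpeed τ i) (Ioo 0 (τ i)) :=
  (continuousOn_slopeX hτ i).div (by fun_prop) fun _ hu =>
    (Real.sqrt_pos.2 (one_sub_sq_pos hτ i (abs_lt_of_mem_Ioo_zero hu))).ne'

theorem intervalIntegrable_deriv_arcsin_claspX (hτ : ∀ i, 0 < τ i ∧ τ i ≤ 1) (i : Fin 2) :
    IntervalIntegrable (fun u => 1 / √(1 - claspX τ i u ^ 2) * slopeX τ i u)
      volume 0 (τ i) := by
  have hi := (hτ i).1.le
  refine intervalIntegral.intervalIntegrable_deriv_of_nonneg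
    (g := fun u => Real.arcsin (claspX τ i u)) ?_ ?_ ?_
  · rw [uIcc_of_le hi]
    exact Real.continuous_arcsin.comp_continuousOn
      ((continuousOn_claspX hτ i).mono fun u hu => abs_le.1 (abs_le_of_mem_Icc_zero hu))
  all_goals
    rw [min_eq_left hi, max_eq_right hi]
    intro u hu
  · have hu' : |u| < τ i := abs_lt_of_mem_Ioo_zero hu
    have hlt : |claspX τ i u| < 1 := by
      rw [← sq_lt_one_iff_abs_lt_one, ← sub_pos, one_sub_claspX_sq hτ i hu'.le]
      exact div_pos (one_sub_sq_pos hτ i hu') (one_sub_sq_mul_partner_sq_pos hτ i hu'.le)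
    exact (Real.hasDerivAt_arcsin (abs_lt.1 hlt).1.ne' (abs_lt.1 hlt).2.ne).comp u
      (hasDerivAt_claspX hτ i hu)
  · have := slopeX_pos hτ i hu
    positivity

/-- The curved part has finite length, even where it becomes vertical: up to a bounded factor
the speed is the derivative of the monotone function `arcsin ∘ claspX`. -/
theorem intervalIntegrable_curvedSpeed (hτ : ∀ i, 0 < τ i ∧ τ i ≤ 1) (i : Fin 2) :
    IntervalIntegrable (curvedSpeed τ i) volume 0 (τ i) := by
  have hi := (hτ i).1.le
  have hfactor : ContinuousOn (fun u => 1 / √(1 - u ^ 2 * partner τ i u ^ 2)) [[0, τ i]] := by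
    have hp := continuous_partner τ i
    rw [uIcc_of_le hi]
    exact ContinuousOn.div continuousOn_const (by fun_prop) fun u hu =>
      (Real.sqrt_pos.2 (one_sub_sq_mul_partner_sq_pos hτ i (abs_le_of_mem_Icc_zero hu))).ne'
  refine ((intervalIntegrable_deriv_arcsin_claspX hτ i).mul_continuousOn hfactor).congr_uIoo
    fun u hu => ?_
  rw [uIoo_of_le hi] at hu
  have hu' : |u| < τ i := abs_lt_of_mem_Ioo_zero hu
  have hden := (Real.sqrt_pos.2 (one_sub_sq_mul_partner_sq_pos hτ i hu'.le)).ne'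
  have hnum := (Real.sqrt_pos.2 (one_sub_sq_pos hτ i hu')).ne'
  simp only [curvedSpeed]
  rw [one_sub_claspX_sq hτ i hu'.le, Real.sqrt_div (one_sub_sq_nonneg hτ i hu'.le)]
  field_simp

theorem riseIntegrand_eq (hτ : ∀ i, 0 < τ i ∧ τ i ≤ 1) (i : Fin 2) {u : ℝ}
    (hu : u ∈ Ioo 0 (τ i)) :
    u / √(1 - u ^ 2) * deriv (claspX τ i) u = u * curvedSpeed τ i u := by
  rw [(hasDerivAt_claspX hτ i hu).deriv, curvedSpeed]
  ring

theorem intervalIntegrable_riseIntegrand (hτ : ∀ i, 0 < τ i ∧ τ i ≤ 1) (i : Fin 2) :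
    IntervalIntegrable (fun u => u / √(1 - u ^ 2) * deriv (claspX τ i) u) volume 0 (τ i) := by
  refine ((intervalIntegrable_curvedSpeed hτ i).continuousOn_mul continuousOn_id).congr_uIoo
    fun u hu => ?_
  rw [uIoo_of_le (hτ i).1.le] at hu
  exact (riseIntegrand_eq hτ i hu).symm

theorem claspRise_neg (τ : Fin 2 → ℝ) (i : Fin 2) (u : ℝ) :
    claspRise τ i (-u) = claspRise τ i u := by
  simp [claspRise]

theorem claspRise_zero (τ : Fin 2 → ℝ) (i : Fin 2) : claspRise τ i 0 = 0 := by simp [claspRise]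

theorem continuousOn_claspRise (hτ : ∀ i, 0 < τ i ∧ τ i ≤ 1) (i : Fin 2) :
    ContinuousOn (claspRise τ i) (Icc (-τ i) (τ i)) := by
  have h := intervalIntegral.continuousOn_primitive_interval'
    (intervalIntegrable_riseIntegrand hτ i) left_mem_uIcc
  rw [uIcc_of_le (hτ i).1.le] at h
  exact h.comp continuous_abs.continuousOn fun u hu => ⟨abs_nonneg u, abs_le.2 hu⟩

theorem hasDerivAt_claspRise (hτ : ∀ i, 0 < τ i ∧ τ i ≤ 1) (i : Fin 2) {u : ℝ}
    (hu : u ∈ Ioo 0 (τ i)) : HasDerivAt (claspRise τ i) (u * curvedSpeed τ i u) u := by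
  have hcont : ContinuousOn (fun s => s / √(1 - s ^ 2) * deriv (claspX τ i) s)
      (Ioo 0 (τ i)) :=
    (continuousOn_id.mul (continuousOn_curvedSpeed hτ i)).congr fun s hs =>
      riseIntegrand_eq hτ i hs
  have hnhds := Ioo_mem_nhds hu.1 hu.2
  have h := intervalIntegral.integral_hasDerivAt_right
    ((intervalIntegrable_riseIntegrand hτ i).mono_set
      (uIcc_subset_uIcc_left (Icc_subset_uIcc (Ioo_subset_Icc_self hu))))
    (hcont.stronglyMeasurableAtFilter isOpen_Ioo u hu) (hcont.continuousAt hnhds)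
  rw [riseIntegrand_eq hτ i hu] at h
  refine h.congr_of_eventuallyEq ?_
  filter_upwards [hnhds] with s hs
  simp [claspRise, abs_of_pos hs.1]

theorem strictMonoOn_claspRise (hτ : ∀ i, 0 < τ i ∧ τ i ≤ 1) (i : Fin 2) :
    StrictMonoOn (claspRise τ i) (Icc 0 (τ i)) := by
  refine strictMonoOn_of_deriv_pos (convex_Icc _ _)
    ((continuousOn_claspRise hτ i).mono fun u hu => abs_le.1 (abs_le_of_mem_Icc_zero hu))
    fun u hu => ?_
  rw [interior_Icc] at hu
  rw [(hasDerivAt_claspRise hτ i hu).deriv]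
  exact mul_pos hu.1 (curvedSpeed_pos hτ i hu)

end Profile

section Struts

variable {τ : Fin 2 → ℝ}

/-- The balance relation between a parameter `u` on component `i` and a parameter `v` on the
other component: the points with balanced parameters are joined by the struts of the clasp. -/
def Balanced (τ : Fin 2 → ℝ) (i : Fin 2) (u v : ℝ) : Prop := |u| / τ i + |v| / τ i.rev = 1

/-- The height of a strut between points with parameters `u` and `v`. -/
def strutHeight (u v : ℝ) : ℝ := √((1 - u ^ 2) * (1 - v ^ 2) / (1 - u ^ 2 * v ^ 2))

theorem strutHeight_nonneg (u v : ℝ) : 0 ≤ strutHeight u v := Real.sqrt_nonneg _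

theorem strutHeight_comm (u v : ℝ) : strutHeight u v = strutHeight v u := by
  simp only [strutHeight, mul_comm]

theorem strutHeight_abs (u v : ℝ) : strutHeight |u| |v| = strutHeight u v := by
  simp only [strutHeight, sq_abs]

theorem partner_abs (τ : Fin 2 → ℝ) (i : Fin 2) (u : ℝ) : partner τ i |u| = partner τ i u := by
  simp only [partner, abs_abs]

theorem claspRise_abs (τ : Fin 2 → ℝ) (i : Fin 2) (u : ℝ) :
    claspRise τ i |u| = claspRise τ i u := by
  simp only [claspRise, abs_abs]

theorem balanced_partner (hτ : ∀ i, 0 < τ i ∧ τ i ≤ 1) {i : Fin 2} {u : ℝ} (hu : |u| ≤ τ i) :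
    Balanced τ i u (partner τ i u) := by
  have := (hτ i.rev).1.ne'
  rw [Balanced, abs_of_nonneg (partner_mem_Icc hτ i hu).1, partner]
  field_simp
  ring

namespace Balanced

variable {i : Fin 2} {u v : ℝ}

theorem symm (h : Balanced τ i u v) : Balanced τ i.rev v u := by
  rwa [Balanced, Fin.rev_rev, add_comm]

theorem abs_left_le (hτ : ∀ i, 0 < τ i ∧ τ i ≤ 1) (h : Balanced τ i u v) : |u| ≤ τ i := by
  have hv : 0 ≤ |v| / τ i.rev := div_nonneg (abs_nonneg v) (hτ i.rev).1.le
  rw [← div_le_one (hτ i).1]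
  linarith [show |u| / τ i + |v| / τ i.rev = 1 from h]

theorem abs_right_le (hτ : ∀ i, 0 < τ i ∧ τ i ≤ 1) (h : Balanced τ i u v) : |v| ≤ τ i.rev :=
  h.symm.abs_left_le hτ

theorem partner_eq (hτ : ∀ i, 0 < τ i ∧ τ i ≤ 1) (h : Balanced τ i u v) :
    partner τ i u = |v| := by
  rw [partner, ← eq_sub_of_add_eq' h, mul_div_cancel₀ _ (hτ i.rev).1.ne']

theorem one_sub_sq_mul_sq_pos (hτ : ∀ i, 0 < τ i ∧ τ i ≤ 1) (h : Balanced τ i u v) :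
    0 < 1 - u ^ 2 * v ^ 2 := by
  have := one_sub_sq_mul_partner_sq_pos hτ i (h.abs_left_le hτ)
  rwa [h.partner_eq hτ, sq_abs] at this

theorem strutHeight_sq (hτ : ∀ i, 0 < τ i ∧ τ i ≤ 1) (h : Balanced τ i u v) :
    strutHeight u v ^ 2 = (1 - u ^ 2) * (1 - v ^ 2) / (1 - u ^ 2 * v ^ 2) :=
  Real.sq_sqrt (div_nonneg (mul_nonneg (one_sub_sq_nonneg hτ i (h.abs_left_le hτ))
    (one_sub_sq_nonneg hτ i.rev (h.abs_right_le hτ))) (h.one_sub_sq_mul_sq_pos hτ).le)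

theorem claspX_sq (hτ : ∀ i, 0 < τ i ∧ τ i ≤ 1) (h : Balanced τ i u v) :
    claspX τ i u ^ 2 = u ^ 2 * (1 - v ^ 2) / (1 - u ^ 2 * v ^ 2) := by
  rw [Clasp.claspX_sq hτ i (h.abs_left_le hτ), h.partner_eq hτ, sq_abs]

theorem claspX_mul_sqrt (hτ : ∀ i, 0 < τ i ∧ τ i ≤ 1) (h : Balanced τ i u v) :
    claspX τ i u * √(1 - u ^ 2) = u * strutHeight u v := by
  rw [claspX, strutHeight, mul_assoc, mul_comm √(_ / _),
    ← Real.sqrt_mul (one_sub_sq_nonneg hτ i (h.abs_left_le hτ)), mul_div_assoc,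
    h.partner_eq hτ, sq_abs]

/-- The struts have length `1`, because a strut projects to the horizontal vector with
coordinates `claspX τ i u` and `claspX τ i.rev v`. -/
theorem sq_add_sq_add_sq (hτ : ∀ i, 0 < τ i ∧ τ i ≤ 1) (h : Balanced τ i u v) :
    claspX τ i u ^ 2 + claspX τ i.rev v ^ 2 + strutHeight u v ^ 2 = 1 := by
  have hden := (h.one_sub_sq_mul_sq_pos hτ).ne'
  rw [h.claspX_sq hτ, h.symm.claspX_sq hτ, h.strutHeight_sq hτ, mul_comm (v ^ 2) (u ^ 2)]
  field_simp
  ring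

end Balanced

theorem strutHeight_partner_eq_sqrt (hτ : ∀ i, 0 < τ i ∧ τ i ≤ 1) (i : Fin 2) {u : ℝ}
    (hu : |u| ≤ τ i) :
    strutHeight u (partner τ i u) =
      √(1 - claspX τ i u ^ 2 - claspX τ i.rev (partner τ i u) ^ 2) := by
  rw [← Real.sqrt_sq (strutHeight_nonneg u (partner τ i u))]
  congr 1
  linarith [(balanced_partner hτ hu).sq_add_sq_add_sq hτ]

theorem strutHeight_partner_pos (hτ : ∀ i, 0 < τ i ∧ τ i ≤ 1) (i : Fin 2) {u : ℝ}
    (hu : u ∈ Ioo 0 (τ i)) : 0 < strutHeight u (partner τ i u) := by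
  have hu' : |u| < τ i := abs_lt_of_mem_Ioo_zero hu
  exact Real.sqrt_pos.2 (div_pos (mul_pos (one_sub_sq_pos hτ i hu')
    (one_sub_sq_pos hτ i.rev (abs_lt_of_mem_Ioo_zero (partner_mem_Ioo hτ i hu))))
    (one_sub_sq_mul_partner_sq_pos hτ i hu'.le))

theorem hasDerivAt_strutHeight_partner (hτ : ∀ i, 0 < τ i ∧ τ i ≤ 1) (i : Fin 2) {u : ℝ}
    (hu : u ∈ Ioo 0 (τ i)) :
    HasDerivAt (fun s => strutHeight s (partner τ i s))
      (-(u * curvedSpeed τ i u) -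
        partner τ i u * curvedSpeed τ i.rev (partner τ i u) * -(τ i.rev / τ i)) u := by
  have hu' : |u| ≤ τ i := (abs_lt_of_mem_Ioo_zero hu).le
  have hp := partner_mem_Ioo hτ i hu
  have hheight := strutHeight_partner_pos hτ i hu
  have hsqrt := strutHeight_partner_eq_sqrt hτ i hu'
  have hbal := balanced_partner hτ hu'
  have hx := hasDerivAt_claspX hτ i hu
  have hx' := (hasDerivAt_claspX hτ i.rev hp).comp u (hasDerivAt_partner τ i hu.1)
  have hsqrt' := ((hx.pow 2).const_sub 1 |>.sub (hx'.pow 2)).sqrt (by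
    simp only [Pi.sub_apply, Pi.pow_apply, Function.comp_apply]
    exact (Real.sqrt_pos.1 (hsqrt ▸ hheight)).ne')
  have hev : (fun s => strutHeight s (partner τ i s)) =ᶠ[𝓝 u] fun s =>
      √(1 - claspX τ i s ^ 2 - claspX τ i.rev (partner τ i s) ^ 2) := by
    filter_upwards [Ioo_mem_nhds hu.1 hu.2] with s hs
    exact strutHeight_partner_eq_sqrt hτ i (abs_lt_of_mem_Ioo_zero hs).le
  refine (hsqrt'.congr_of_eventuallyEq hev).congr_deriv ?_
  have hleft := hbal.claspX_mul_sqrt hτ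
  have hright := hbal.symm.claspX_mul_sqrt hτ
  rw [strutHeight_comm] at hright
  simp only [Pi.sub_apply, Pi.pow_apply, Function.comp_apply]
  rw [← hsqrt, ← sqrt_mul_curvedSpeed hτ i hu, ← sqrt_mul_curvedSpeed hτ i.rev hp]
  have := (hτ i).1.ne'
  field_simp
  push_cast
  simp only [pow_one]
  linear_combination (-2 * curvedSpeed τ i u * τ i) * hleft +
    (2 * curvedSpeed τ i.rev (partner τ i u) * τ i.rev) * hright

theorem continuousOn_strutHeight_partner (hτ : ∀ i, 0 < τ i ∧ τ i ≤ 1) (i : Fin 2) :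
    ContinuousOn (fun u => strutHeight u (partner τ i u)) (Icc 0 (τ i)) := by
  have hp := continuous_partner τ i
  exact ContinuousOn.sqrt (ContinuousOn.div (by fun_prop) (by fun_prop) fun u hu =>
    (one_sub_sq_mul_partner_sq_pos hτ i (abs_le_of_mem_Icc_zero hu)).ne')

/-- The two rises and the strut height have derivatives that cancel. -/
theorem claspRise_add_claspRise_add_strutHeight_partner (hτ : ∀ i, 0 < τ i ∧ τ i ≤ 1)
    (i : Fin 2) {u : ℝ} (hu : u ∈ Icc 0 (τ i)) :
    claspRise τ i u + claspRise τ i.rev (partner τ i u) + strutHeight u (partner τ i u) =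
      claspRise τ i.rev (τ i.rev) + √(1 - τ i.rev ^ 2) := by
  let D (s : ℝ) : ℝ := claspRise τ i s + claspRise τ i.rev (partner τ i s) +
    strutHeight s (partner τ i s)
  have hD0 : D 0 = claspRise τ i.rev (τ i.rev) + √(1 - τ i.rev ^ 2) := by
    simp [D, partner_zero, claspRise_zero, strutHeight]
  have hcont : ContinuousOn D (Icc 0 (τ i)) := by
    refine ContinuousOn.add (ContinuousOn.add ?_ ?_) (continuousOn_strutHeight_partner hτ i)
    · exact (continuousOn_claspRise hτ i).mono fun s hs => abs_le.1 (abs_le_of_mem_Icc_zero hs)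
    · exact (continuousOn_claspRise hτ i.rev).comp (continuous_partner τ i).continuousOn
        fun s hs => abs_le.1 (abs_partner_le hτ i (abs_le_of_mem_Icc_zero hs))
  have hderiv : ∀ s ∈ Ioo 0 (τ i), HasDerivAt D 0 s := fun s hs =>
    (((hasDerivAt_claspRise hτ i hs).add
      ((hasDerivAt_claspRise hτ i.rev (partner_mem_Ioo hτ i hs)).comp s
        (hasDerivAt_partner τ i hs.1))).add
      (hasDerivAt_strutHeight_partner hτ i hs)).congr_deriv (by ring)
  rw [← hD0]
  rcases hu.1.eq_or_lt with rfl | hu0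
  · rfl
  · obtain ⟨s, -, hs⟩ := exists_hasDerivAt_eq_slope D (fun _ => 0) hu0
      (hcont.mono (Icc_subset_Icc_right hu.2)) fun s hs => hderiv s ⟨hs.1, hs.2.trans_le hu.2⟩
    exact sub_eq_zero.1 ((div_eq_zero_iff.1 hs.symm).resolve_right (by simpa using hu0.ne'))

theorem Balanced.claspRise_add_claspRise_add_strutHeight (hτ : ∀ i, 0 < τ i ∧ τ i ≤ 1)
    {i : Fin 2} {u v : ℝ} (h : Balanced τ i u v) :
    claspRise τ i u + claspRise τ i.rev v + strutHeight u v = tipHeight τ 1 := by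
  have key {u v : ℝ} (h : Balanced τ 0 u v) :
      claspRise τ 0 u + claspRise τ 1 v + strutHeight u v = tipHeight τ 1 := by
    have hclosed := claspRise_add_claspRise_add_strutHeight_partner hτ 0
      ⟨abs_nonneg u, h.abs_left_le hτ⟩
    rw [partner_abs, h.partner_eq hτ, claspRise_abs, claspRise_abs, strutHeight_abs] at hclosed
    exact hclosed.trans (add_comm _ _)
  fin_cases i
  · exact key h
  · rw [add_comm (claspRise _ _ _), strutHeight_comm]
    exact key h.symm

theorem tipHeight_one_eq (hτ : ∀ i, 0 < τ i ∧ τ i ≤ 1) (i : Fin 2) :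
    tipHeight τ 1 = √(1 - τ i ^ 2) + claspRise τ i (τ i) := by
  have h : Balanced τ i (τ i) 0 := by simp [Balanced, abs_of_pos (hτ i).1, (hτ i).1.ne']
  rw [← h.claspRise_add_claspRise_add_strutHeight hτ, claspRise_zero, add_zero, add_comm]
  simp [strutHeight]

end Struts

section PlanePoint

theorem planePoint_eq (i : Fin 2) (x z : ℝ) :
    planePoint i x z = !₂[if i = 0 then x else 0, if i = 1 then x else 0, z] := by
  ext k
  fin_cases i <;> fin_cases k <;> simp [planePoint]

theorem inner_planePoint (i j : Fin 2) (x z x' z' : ℝ) :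
    inner ℝ (planePoint i x z) (planePoint j x' z') = (if i = j then x * x' else 0) + z * z' := by
  simp only [planePoint_eq, PiLp.inner_apply, Fin.sum_univ_three]
  fin_cases i <;> fin_cases j <;> simp [mul_comm]

theorem norm_sq_planePoint (i : Fin 2) (x z : ℝ) : ‖planePoint i x z‖ ^ 2 = x ^ 2 + z ^ 2 := by
  rw [← real_inner_self_eq_norm_sq, inner_planePoint, if_pos rfl, sq, sq]

theorem smul_planePoint (i : Fin 2) (a x z : ℝ) :
    a • planePoint i x z = planePoint i (a * x) (a * z) := by
  simp only [planePoint_eq]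
  ext k
  fin_cases i <;> fin_cases k <;> simp

theorem planePoint_add (i : Fin 2) (x z x' z' : ℝ) :
    planePoint i x z + planePoint i x' z' = planePoint i (x + x') (z + z') := by
  simp only [planePoint_eq]
  ext k
  fin_cases i <;> fin_cases k <;> simp

theorem planePoint_sub (i : Fin 2) (x z x' z' : ℝ) :
    planePoint i x z - planePoint i x' z' = planePoint i (x - x') (z - z') := by
  simp only [planePoint_eq]
  ext k
  fin_cases i <;> fin_cases k <;> simp

theorem planePoint_eq_smul_add_smul (i : Fin 2) (x z : ℝ) :
    planePoint i x z = x • planePoint i 1 0 + z • planePoint i 0 1 := by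
  rw [smul_planePoint, smul_planePoint, planePoint_add]
  simp

theorem planePoint_inj {i : Fin 2} {x z x' z' : ℝ} (h : planePoint i x z = planePoint i x' z') :
    x = x' ∧ z = z' := by
  have hsub : ‖planePoint i (x - x') (z - z')‖ ^ 2 = 0 := by
    rw [← planePoint_sub, h, sub_self, norm_zero, sq, zero_mul]
  rw [norm_sq_planePoint] at hsub
  constructor <;> nlinarith [sq_nonneg (x - x'), sq_nonneg (z - z')]

theorem dist_planePoint_sq {i j : Fin 2} (hij : i ≠ j) (x z x' z' : ℝ) :
    dist (planePoint i x z) (planePoint j x' z') ^ 2 = x ^ 2 + x' ^ 2 + (z' - z) ^ 2 := by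
  rw [dist_eq_norm, norm_sub_sq_real, norm_sq_planePoint, norm_sq_planePoint, inner_planePoint,
    if_neg hij]
  ring

theorem planePoint_eq_planePoint_of_ne {i j : Fin 2} (hij : i ≠ j) {x z x' z' : ℝ}
    (h : planePoint i x z = planePoint j x' z') : x = 0 ∧ x' = 0 ∧ z = z' := by
  have hdist := dist_planePoint_sq hij x z x' z'
  rw [h, dist_self] at hdist
  refine ⟨?_, ?_, ?_⟩ <;> nlinarith [sq_nonneg x, sq_nonneg x', sq_nonneg (z' - z)]

theorem continuous_planePoint {X : Type*} [TopologicalSpace X] (i : Fin 2) {f g : X → ℝ}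
    (hf : Continuous f) (hg : Continuous g) : Continuous fun x => planePoint i (f x) (g x) := by
  simp only [planePoint_eq_smul_add_smul i (f _)]
  fun_prop

theorem hasDerivAt_planePoint (i : Fin 2) {f g : ℝ → ℝ} {f' g' s : ℝ}
    (hf : HasDerivAt f f' s) (hg : HasDerivAt g g' s) :
    HasDerivAt (fun x => planePoint i (f x) (g x)) (planePoint i f' g') s := by
  simp only [planePoint_eq_smul_add_smul i (f _), planePoint_eq_smul_add_smul i f']
  exact (hf.smul_const _).add (hg.smul_const _)

theorem updown_mul_self (i : Fin 2) : updown i * updown i = 1 := by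
  fin_cases i <;> simp [updown]

end PlanePoint

section Arcs

variable {τ : Fin 2 → ℝ}

/-- The parameter on the curved part which is closest to `s`. -/
def clampU (τ : Fin 2 → ℝ) (i : Fin 2) (s : ℝ) : ℝ := max (-τ i) (min (τ i) s)

/-- The horizontal coordinate of `arcPoint`. -/
def arcX (τ : Fin 2 → ℝ) (i : Fin 2) (s : ℝ) : ℝ :=
  claspX τ i (clampU τ i s) + (s - clampU τ i s) * √(1 - τ i ^ 2)

/-- The height of `arcPoint` over the tip (below the tip for the second component). -/
def arcRise (τ : Fin 2 → ℝ) (i : Fin 2) (s : ℝ) : ℝ :=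
  claspRise τ i (clampU τ i s) + (|s| - |clampU τ i s|) * τ i

theorem arcPoint_eq (τ : Fin 2 → ℝ) (i : Fin 2) (s : ℝ) :
    arcPoint τ i s = planePoint i (arcX τ i s) (tipHeight τ i + updown i * arcRise τ i s) := rfl

theorem clampU_neg (hτ : ∀ i, 0 < τ i ∧ τ i ≤ 1) (i : Fin 2) (s : ℝ) :
    clampU τ i (-s) = -clampU τ i s := by
  have hi : -τ i ≤ τ i := neg_le_self (hτ i).1.le
  rw [clampU, clampU, max_min_distrib_left, max_eq_right hi, ← min_neg_neg, neg_neg,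
    ← max_neg_neg, min_comm]

theorem clampU_of_abs_le {i : Fin 2} {s : ℝ} (h : |s| ≤ τ i) : clampU τ i s = s := by
  rw [abs_le] at h
  rw [clampU, min_eq_right h.2, max_eq_right h.1]

theorem clampU_of_ge {i : Fin 2} (hi : 0 ≤ τ i) {s : ℝ} (h : τ i ≤ s) : clampU τ i s = τ i := by
  rw [clampU, min_eq_left h, max_eq_right (neg_le_self hi)]

theorem clampU_mem_Icc {i : Fin 2} (hi : 0 ≤ τ i) (s : ℝ) : clampU τ i s ∈ Icc (-τ i) (τ i) :=
  ⟨le_max_left _ _, max_le (neg_le_self hi) (min_le_left _ _)⟩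

theorem continuous_clampU (τ : Fin 2 → ℝ) (i : Fin 2) : Continuous (clampU τ i) := by
  unfold clampU
  fun_prop

theorem arcX_neg (hτ : ∀ i, 0 < τ i ∧ τ i ≤ 1) (i : Fin 2) (s : ℝ) :
    arcX τ i (-s) = -arcX τ i s := by
  rw [arcX, clampU_neg hτ, claspX_neg, arcX]
  ring

theorem arcX_abs_sq (hτ : ∀ i, 0 < τ i ∧ τ i ≤ 1) (i : Fin 2) (s : ℝ) :
    arcX τ i |s| ^ 2 = arcX τ i s ^ 2 := by
  rcases abs_choice s with h | h <;> rw [h]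
  rw [arcX_neg hτ, neg_sq]

theorem arcRise_neg (hτ : ∀ i, 0 < τ i ∧ τ i ≤ 1) (i : Fin 2) (s : ℝ) :
    arcRise τ i (-s) = arcRise τ i s := by
  rw [arcRise, clampU_neg hτ, claspRise_neg, arcRise, abs_neg, abs_neg]

theorem arcRise_abs (hτ : ∀ i, 0 < τ i ∧ τ i ≤ 1) (i : Fin 2) (s : ℝ) :
    arcRise τ i |s| = arcRise τ i s := by
  rcases abs_choice s with h | h <;> rw [h]
  exact arcRise_neg hτ i s

theorem arcX_of_abs_le {i : Fin 2} {s : ℝ} (h : |s| ≤ τ i) : arcX τ i s = claspX τ i s := by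
  rw [arcX, clampU_of_abs_le h]
  ring

theorem arcRise_of_abs_le {i : Fin 2} {s : ℝ} (h : |s| ≤ τ i) :
    arcRise τ i s = claspRise τ i s := by
  rw [arcRise, clampU_of_abs_le h]
  ring

theorem arcX_of_ge {i : Fin 2} (hi : 0 < τ i) {s : ℝ} (h : τ i ≤ s) :
    arcX τ i s = τ i + (s - τ i) * √(1 - τ i ^ 2) := by
  rw [arcX, clampU_of_ge hi.le h, claspX_self hi]

theorem arcRise_of_ge {i : Fin 2} (hi : 0 < τ i) {s : ℝ} (h : τ i ≤ s) :
    arcRise τ i s = claspRise τ i (τ i) + (s - τ i) * τ i := by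
  rw [arcRise, clampU_of_ge hi.le h, abs_of_pos hi, abs_of_pos (hi.trans_le h)]

theorem arcX_zero (hτ : ∀ i, 0 < τ i ∧ τ i ≤ 1) (i : Fin 2) : arcX τ i 0 = 0 := by
  rw [arcX_of_abs_le (by simpa using (hτ i).1.le), claspX_zero]

theorem arcRise_zero (hτ : ∀ i, 0 < τ i ∧ τ i ≤ 1) (i : Fin 2) : arcRise τ i 0 = 0 := by
  rw [arcRise_of_abs_le (by simpa using (hτ i).1.le), claspRise_zero]

theorem continuous_arcX (hτ : ∀ i, 0 < τ i ∧ τ i ≤ 1) (i : Fin 2) : Continuous (arcX τ i) := by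
  have hclamp := continuous_clampU τ i
  have hcurved : Continuous fun s => claspX τ i (clampU τ i s) :=
    (continuousOn_claspX hτ i).comp_continuous hclamp (clampU_mem_Icc (hτ i).1.le)
  unfold arcX
  fun_prop

theorem continuous_arcRise (hτ : ∀ i, 0 < τ i ∧ τ i ≤ 1) (i : Fin 2) :
    Continuous (arcRise τ i) := by
  have hclamp := continuous_clampU τ i
  have hcurved : Continuous fun s => claspRise τ i (clampU τ i s) :=
    (continuousOn_claspRise hτ i).comp_continuous hclamp (clampU_mem_Icc (hτ i).1.le)
  unfold arcRise
  fun_prop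

theorem continuous_arcPoint (hτ : ∀ i, 0 < τ i ∧ τ i ≤ 1) (i : Fin 2) :
    Continuous (arcPoint τ i) :=
  continuous_planePoint i (continuous_arcX hτ i)
    (continuous_const.add (continuous_const.mul (continuous_arcRise hτ i)))

theorem arcX_pos (hτ : ∀ i, 0 < τ i ∧ τ i ≤ 1) (i : Fin 2) {s : ℝ} (hs : 0 < s) :
    0 < arcX τ i s := by
  have hi := (hτ i).1
  rcases le_total s (τ i) with h | h
  · rw [arcX_of_abs_le (by rwa [abs_of_pos hs])]
    exact claspX_pos hτ i ⟨hs, h⟩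
  · rw [arcX_of_ge hi h]
    exact add_pos_of_pos_of_nonneg hi (mul_nonneg (sub_nonneg.2 h) (Real.sqrt_nonneg _))

theorem monotoneOn_arcX (hτ : ∀ i, 0 < τ i ∧ τ i ≤ 1) (i : Fin 2) :
    MonotoneOn (arcX τ i) (Ici 0) := by
  have hi := (hτ i).1
  have hcurved : MonotoneOn (arcX τ i) (Icc 0 (τ i)) := (monotoneOn_claspX hτ i).congr
    fun s hs => (arcX_of_abs_le (abs_le_of_mem_Icc_zero hs)).symm
  have hstraight : MonotoneOn (arcX τ i) (Ici (τ i)) := fun s hs t ht hst => by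
    rw [arcX_of_ge hi hs, arcX_of_ge hi ht]
    gcongr
  have := hcurved.union_right hstraight (isGreatest_Icc hi.le) isLeast_Ici
  rwa [Icc_union_Ici_eq_Ici hi.le] at this

theorem strictMonoOn_arcRise (hτ : ∀ i, 0 < τ i ∧ τ i ≤ 1) (i : Fin 2) :
    StrictMonoOn (arcRise τ i) (Ici 0) := by
  have hi := (hτ i).1
  have hcurved : StrictMonoOn (arcRise τ i) (Icc 0 (τ i)) := (strictMonoOn_claspRise hτ i).congr
    fun s hs => (arcRise_of_abs_le (abs_le_of_mem_Icc_zero hs)).symm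
  have hstraight : StrictMonoOn (arcRise τ i) (Ici (τ i)) := fun s hs t ht hst => by
    rw [arcRise_of_ge hi hs, arcRise_of_ge hi ht]
    gcongr
  have := hcurved.union hstraight (isGreatest_Icc hi.le) isLeast_Ici
  rwa [Icc_union_Ici_eq_Ici hi.le] at this

theorem abs_arcX (hτ : ∀ i, 0 < τ i ∧ τ i ≤ 1) (i : Fin 2) (s : ℝ) :
    |arcX τ i s| = arcX τ i |s| := by
  have hnonneg : 0 ≤ arcX τ i |s| := by
    rw [← arcX_zero hτ i]
    exact monotoneOn_arcX hτ i self_mem_Ici (abs_nonneg s) (abs_nonneg s)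
  rw [← sq_eq_sq₀ (abs_nonneg _) hnonneg, sq_abs, arcX_abs_sq hτ]

theorem arcRise_nonneg (hτ : ∀ i, 0 < τ i ∧ τ i ≤ 1) (i : Fin 2) (s : ℝ) :
    0 ≤ arcRise τ i s := by
  rw [← arcRise_abs hτ, ← arcRise_zero hτ i]
  exact (strictMonoOn_arcRise hτ i).monotoneOn self_mem_Ici (abs_nonneg s) (abs_nonneg s)

end Arcs

section Thickness

variable {τ : Fin 2 → ℝ}

theorem isMinOn_Icc_of_deriv_nonpos_of_nonneg {f f' : ℝ → ℝ} {a b w : ℝ}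
    (hf : ContinuousOn f (Icc a b)) (hf' : ∀ x ∈ Ioo a b, HasDerivAt f (f' x) x)
    (hw : w ∈ Icc a b) (hnonpos : ∀ x ∈ Ioo a w, f' x ≤ 0) (hnonneg : ∀ x ∈ Ioo w b, 0 ≤ f' x) :
    IsMinOn f (Icc a b) w := by
  intro v hv
  rcases le_total v w with hvw | hwv
  · have hanti : AntitoneOn f (Icc a w) := by
      refine antitoneOn_of_hasDerivWithinAt_nonpos (f' := f') (convex_Icc a w)
        (hf.mono (Icc_subset_Icc_right hw.2)) ?_ ?_ <;> rw [interior_Icc]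
      exacts [fun x hx => (hf' x ⟨hx.1, hx.2.trans_le hw.2⟩).hasDerivWithinAt, hnonpos]
    exact hanti ⟨hv.1, hvw⟩ (right_mem_Icc.2 hw.1) hvw
  · have hmono : MonotoneOn f (Icc w b) := by
      refine monotoneOn_of_hasDerivWithinAt_nonneg (f' := f') (convex_Icc w b)
        (hf.mono (Icc_subset_Icc_left hw.1)) ?_ ?_ <;> rw [interior_Icc]
      exacts [fun x hx => (hf' x ⟨hw.1.trans_lt hx.1, hx.2⟩).hasDerivWithinAt, hnonneg]
    exact hmono (left_mem_Icc.2 hw.2) ⟨hwv, hv.2⟩ hwv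

theorem dist_arcPoint_sq (τ : Fin 2 → ℝ) (s t : ℝ) :
    dist (arcPoint τ 0 s) (arcPoint τ 1 t) ^ 2 =
      arcX τ 0 s ^ 2 + arcX τ 1 t ^ 2 + (tipHeight τ 1 - arcRise τ 0 s - arcRise τ 1 t) ^ 2 := by
  rw [arcPoint_eq, arcPoint_eq, dist_planePoint_sq zero_ne_one]
  simp only [tipHeight, updown, if_true, one_ne_zero, if_false]
  ring

theorem dist_arcPoint_eq_one (hτ : ∀ i, 0 < τ i ∧ τ i ≤ 1) {u v : ℝ} (h : Balanced τ 0 u v) :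
    dist (arcPoint τ 0 u) (arcPoint τ 1 v) = 1 := by
  have hclosed : claspRise τ 0 u + claspRise τ 1 v + strutHeight u v = tipHeight τ 1 :=
    h.claspRise_add_claspRise_add_strutHeight hτ
  have hunit : claspX τ 0 u ^ 2 + claspX τ 1 v ^ 2 + strutHeight u v ^ 2 = 1 :=
    h.sq_add_sq_add_sq hτ
  rw [← pow_eq_one_iff_of_nonneg dist_nonneg two_ne_zero, dist_arcPoint_sq,
    arcX_of_abs_le (h.abs_left_le hτ), arcRise_of_abs_le (h.abs_left_le hτ),
    arcX_of_abs_le (i := 1) (h.abs_right_le hτ), arcRise_of_abs_le (i := 1) (h.abs_right_le hτ),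
    ← hclosed, ← hunit]
  ring

theorem hasDerivAt_dist_arcPoint_sq (hτ : ∀ i, 0 < τ i ∧ τ i ≤ 1) {u s : ℝ} (hu : |u| ≤ τ 0)
    (hs : s ∈ Ioo 0 (τ 1)) :
    HasDerivAt (fun s => dist (arcPoint τ 0 u) (arcPoint τ 1 s) ^ 2)
      (2 * s * curvedSpeed τ 1 s * (claspRise τ 0 u - claspRise τ 0 (partner τ 1 s))) s := by
  have hbal : Balanced τ 1 s (partner τ 1 s) := balanced_partner hτ (abs_lt_of_mem_Ioo_zero hs).le
  have hcoord : (fun s => dist (arcPoint τ 0 u) (arcPoint τ 1 s) ^ 2) =ᶠ[𝓝 s] fun s =>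
      claspX τ 0 u ^ 2 + claspX τ 1 s ^ 2 +
        (tipHeight τ 1 - claspRise τ 0 u - claspRise τ 1 s) ^ 2 := by
    filter_upwards [Ioo_mem_nhds hs.1 hs.2] with r hr
    have hr' : |r| ≤ τ 1 := (abs_lt_of_mem_Ioo_zero hr).le
    rw [dist_arcPoint_sq, arcX_of_abs_le hu, arcRise_of_abs_le hu, arcX_of_abs_le hr',
      arcRise_of_abs_le hr']
  refine ((((hasDerivAt_claspX hτ 1 hs).pow 2).const_add _).add
    (((hasDerivAt_claspRise hτ 1 hs).const_sub _).pow 2)).congr_of_eventuallyEq hcoord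
    |>.congr_deriv ?_
  have hclosed : claspRise τ 1 s + claspRise τ 0 (partner τ 1 s) + strutHeight s (partner τ 1 s) =
      tipHeight τ 1 := hbal.claspRise_add_claspRise_add_strutHeight hτ
  rw [← sqrt_mul_curvedSpeed hτ 1 hs, ← hclosed]
  push_cast
  rw [pow_one, pow_one]
  linear_combination (2 * curvedSpeed τ 1 s) * hbal.claspX_mul_sqrt hτ

theorem one_le_dist_arcPoint_sq_of_mem_Icc (hτ : ∀ i, 0 < τ i ∧ τ i ≤ 1) {u v : ℝ}
    (hu : u ∈ Icc 0 (τ 0)) (hv : v ∈ Icc 0 (τ 1)) :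
    1 ≤ dist (arcPoint τ 0 u) (arcPoint τ 1 v) ^ 2 := by
  have hu' : |u| ≤ τ 0 := abs_le_of_mem_Icc_zero hu
  have hbal : Balanced τ 0 u (partner τ 0 u) := balanced_partner hτ hu'
  have hw : partner τ 0 u ∈ Icc 0 (τ 1) := partner_mem_Icc hτ 0 hu'
  have hpw : partner τ 1 (partner τ 0 u) = u :=
    (hbal.symm.partner_eq hτ).trans (abs_of_nonneg hu.1)
  have hmem {s : ℝ} (hs : s ∈ Ioo 0 (τ 1)) : partner τ 1 s ∈ Icc 0 (τ 0) :=
    partner_mem_Icc hτ 1 (abs_lt_of_mem_Ioo_zero hs).le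
  have hspeed {s : ℝ} (hs : s ∈ Ioo 0 (τ 1)) : 0 ≤ 2 * s * curvedSpeed τ 1 s :=
    mul_nonneg (mul_nonneg two_pos.le hs.1.le) (curvedSpeed_pos hτ 1 hs).le
  have hmin : IsMinOn (fun s => dist (arcPoint τ 0 u) (arcPoint τ 1 s) ^ 2) (Icc 0 (τ 1))
      (partner τ 0 u) := by
    refine isMinOn_Icc_of_deriv_nonpos_of_nonneg
      ((continuous_const.dist (continuous_arcPoint hτ 1)).pow 2).continuousOn
      (fun s hs => hasDerivAt_dist_arcPoint_sq hτ hu' hs) hw (fun s hs => ?_) (fun s hs => ?_)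
    · have hs' : s ∈ Ioo 0 (τ 1) := ⟨hs.1, hs.2.trans_le hw.2⟩
      have hpart : u ≤ partner τ 1 s := by
        rw [← hpw]
        exact partner_le_partner hτ 1 (abs_le_abs_of_nonneg hs'.1.le hs.2.le)
      exact mul_nonpos_of_nonneg_of_nonpos (hspeed hs')
        (sub_nonpos.2 ((strictMonoOn_claspRise hτ 0).monotoneOn hu (hmem hs') hpart))
    · have hs' : s ∈ Ioo 0 (τ 1) := ⟨hw.1.trans_lt hs.1, hs.2⟩
      have hpart : partner τ 1 s ≤ u := by
        rw [← hpw]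
        exact partner_le_partner hτ 1 (abs_le_abs_of_nonneg hw.1 hs.1.le)
      exact mul_nonneg (hspeed hs')
        (sub_nonneg.2 ((strictMonoOn_claspRise hτ 0).monotoneOn (hmem hs') hu hpart))
  calc (1 : ℝ) = dist (arcPoint τ 0 u) (arcPoint τ 1 (partner τ 0 u)) ^ 2 := by
        rw [dist_arcPoint_eq_one hτ hbal, one_pow]
    _ ≤ dist (arcPoint τ 0 u) (arcPoint τ 1 v) ^ 2 := hmin hv

/-- Moving outwards along a straight end increases the distance to the points on the other
side of the tip. -/
theorem arcX_min_sq_add_sq_le (hτ : ∀ i, 0 < τ i ∧ τ i ≤ 1) (i : Fin 2) {s R : ℝ} (hR : 0 ≤ R) :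
    arcX τ i (min s (τ i)) ^ 2 + (tipHeight τ 1 - arcRise τ i (min s (τ i)) - R) ^ 2 ≤
      arcX τ i s ^ 2 + (tipHeight τ 1 - arcRise τ i s - R) ^ 2 := by
  have hi : 0 < τ i := (hτ i).1
  rcases le_total s (τ i) with h | h
  · rw [min_eq_left h]
  · rw [min_eq_right h, arcX_of_ge hi h, arcX_of_ge hi le_rfl, arcRise_of_ge hi h,
      arcRise_of_ge hi le_rfl, tipHeight_one_eq hτ i]
    have hgain : 0 ≤ (s - τ i) ^ 2 + 2 * ((s - τ i) * τ i * R) :=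
      add_nonneg (sq_nonneg _) (by have := sub_nonneg.2 h; positivity)
    have hsqrt : √(1 - τ i ^ 2) ^ 2 = 1 - τ i ^ 2 :=
      Real.sq_sqrt (one_sub_sq_nonneg hτ i (abs_of_pos hi).le)
    linear_combination hgain - (s - τ i) ^ 2 * hsqrt

theorem one_le_dist_arcPoint (hτ : ∀ i, 0 < τ i ∧ τ i ≤ 1) (s t : ℝ) :
    1 ≤ dist (arcPoint τ 0 s) (arcPoint τ 1 t) := by
  have hclamp (i : Fin 2) (r : ℝ) : min |r| (τ i) ∈ Icc 0 (τ i) :=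
    ⟨le_min (abs_nonneg r) (hτ i).1.le, min_le_right _ _⟩
  have hcurved := one_le_dist_arcPoint_sq_of_mem_Icc hτ (hclamp 0 s) (hclamp 1 t)
  have hend0 := arcX_min_sq_add_sq_le hτ 0 (s := |s|) (arcRise_nonneg hτ 1 (min |t| (τ 1)))
  have hend1 := arcX_min_sq_add_sq_le hτ 1 (s := |t|) (arcRise_nonneg hτ 0 |s|)
  refine (one_le_sq_iff₀ dist_nonneg).1 ?_
  rw [dist_arcPoint_sq] at hcurved ⊢
  rw [← arcX_abs_sq hτ 0 s, ← arcX_abs_sq hτ 1 t, ← arcRise_abs hτ 0 s, ← arcRise_abs hτ 1 t]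
  linarith

end Thickness

section Levels

variable {τ c : Fin 2 → ℝ}

theorem eq_rev_of_ne : ∀ {i j : Fin 2}, i ≠ j → j = i.rev := by decide

/-- The sign of the `xᵢ`-coordinate at the initial (`false`) or final (`true`) end of an arc. -/
def endSign (b : Bool) : ℝ := if b then 1 else -1

theorem abs_endSign (b : Bool) : |endSign b| = 1 := by cases b <;> simp [endSign]

theorem endSign_ne_zero (b : Bool) : endSign b ≠ 0 := by cases b <;> simp [endSign]

theorem endSign_mul_self (b : Bool) : endSign b * endSign b = 1 := by cases b <;> simp [endSign]

theorem endSign_mul_le_abs (b : Bool) (x : ℝ) : endSign b * x ≤ |x| := by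
  simpa only [abs_mul, abs_endSign, one_mul] using le_abs_self (endSign b * x)

theorem normal_eq (τ : Fin 2 → ℝ) (i : Fin 2) (b : Bool) :
    normal τ i b = planePoint i (endSign b * √(1 - τ i ^ 2)) (updown i * τ i) := rfl

theorem norm_normal (hτ : ∀ i, 0 < τ i ∧ τ i ≤ 1) (i : Fin 2) (b : Bool) :
    ‖normal τ i b‖ = 1 := by
  rw [← pow_eq_one_iff_of_nonneg (norm_nonneg _) two_ne_zero, normal_eq, norm_sq_planePoint,
    mul_pow, mul_pow, Real.sq_sqrt (one_sub_sq_nonneg hτ i (abs_of_pos (hτ i).1).le), sq (updown i),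
    updown_mul_self, sq (endSign b), endSign_mul_self]
  ring

theorem inner_normal_arcPoint_self (τ : Fin 2 → ℝ) (i : Fin 2) (b : Bool) (s : ℝ) :
    inner ℝ (normal τ i b) (arcPoint τ i s) =
      endSign b * √(1 - τ i ^ 2) * arcX τ i s +
        τ i * (updown i * tipHeight τ i + arcRise τ i s) := by
  rw [normal_eq, arcPoint_eq, inner_planePoint, if_pos rfl]
  linear_combination (τ i * arcRise τ i s) * updown_mul_self i

theorem inner_normal_planePoint_of_ne {i j : Fin 2} (hij : j ≠ i) (b : Bool) (x z : ℝ) :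
    inner ℝ (normal τ j b) (planePoint i x z) = updown j * τ j * z := by
  rw [normal, inner_planePoint, if_neg hij, zero_add]

/-- By symmetry, the curved part of an arc ends at the level of the tip of the other arc. -/
theorem bendLevel_eq (hτ : ∀ i, 0 < τ i ∧ τ i ≤ 1) (i : Fin 2) :
    bendLevel τ i = updown i * τ i * tipHeight τ i.rev := by
  have htip : tipHeight τ 1 + updown i * tipHeight τ i = updown i * tipHeight τ i.rev := by
    fin_cases i <;> simp [updown, tipHeight]
  have hsum : bendLevel τ i = τ i * (tipHeight τ 1 + updown i * tipHeight τ i) := by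
    rw [bendLevel, inner_normal_arcPoint_self, arcX_of_ge (hτ i).1 le_rfl,
      arcRise_of_ge (hτ i).1 le_rfl, tipHeight_one_eq hτ i, endSign, if_pos rfl]
    ring
  rw [hsum, htip]
  ring

theorem inner_normal_arcPoint_rev (hτ : ∀ i, 0 < τ i ∧ τ i ≤ 1) (i : Fin 2) (b : Bool) (s : ℝ) :
    inner ℝ (normal τ i b) (arcPoint τ i.rev s) = bendLevel τ i - τ i * arcRise τ i.rev s := by
  have hne : i ≠ i.rev := by fin_cases i <;> decide
  have hsign : updown i * updown i.rev = -1 := by fin_cases i <;> simp [updown]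
  rw [arcPoint_eq, inner_normal_planePoint_of_ne hne, bendLevel_eq hτ]
  linear_combination τ i * arcRise τ i.rev s * hsign

/-- Half the length of the parameter interval of the `i`th arc. -/
def halfLength (τ c : Fin 2 → ℝ) (i : Fin 2) : ℝ := τ i + (c i - bendLevel τ i)

theorem lt_halfLength {i : Fin 2} (hi : bendLevel τ i < c i) : τ i < halfLength τ c i :=
  lt_add_of_pos_right _ (sub_pos.2 hi)

theorem inner_normal_arcPoint_of_ge (hτ : ∀ i, 0 < τ i ∧ τ i ≤ 1) (i : Fin 2) {s : ℝ}
    (hs : τ i ≤ s) : inner ℝ (normal τ i true) (arcPoint τ i s) = bendLevel τ i + (s - τ i) := by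
  have hi : 0 < τ i := (hτ i).1
  have hsqrt : √(1 - τ i ^ 2) ^ 2 = 1 - τ i ^ 2 :=
    Real.sq_sqrt (one_sub_sq_nonneg hτ i (abs_of_pos hi).le)
  rw [bendLevel, inner_normal_arcPoint_self, inner_normal_arcPoint_self, arcX_of_ge hi hs,
    arcX_of_ge hi le_rfl, arcRise_of_ge hi hs, arcRise_of_ge hi le_rfl, endSign, if_pos rfl]
  linear_combination (s - τ i) * hsqrt

theorem inner_normal_arcPoint_end (hτ : ∀ i, 0 < τ i ∧ τ i ≤ 1) {i : Fin 2}
    (hi : bendLevel τ i < c i) (b : Bool) :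
    inner ℝ (normal τ i b) (arcPoint τ i (endSign b * halfLength τ c i)) = c i := by
  have hrefl : inner ℝ (normal τ i b) (arcPoint τ i (endSign b * halfLength τ c i)) =
      inner ℝ (normal τ i true) (arcPoint τ i (halfLength τ c i)) := by
    rw [inner_normal_arcPoint_self, inner_normal_arcPoint_self]
    cases b <;> simp [endSign, arcX_neg hτ, arcRise_neg hτ]
  rw [hrefl, inner_normal_arcPoint_of_ge hτ i (lt_halfLength hi).le, halfLength]
  ring

theorem inner_normal_arcPoint_self_le (hτ : ∀ i, 0 < τ i ∧ τ i ≤ 1) {i : Fin 2}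
    (hi : bendLevel τ i < c i) (b : Bool) {s : ℝ} (hs : |s| ≤ halfLength τ c i) :
    inner ℝ (normal τ i b) (arcPoint τ i s) ≤ c i := by
  have hpos : (0 : ℝ) ≤ halfLength τ c i := (abs_nonneg s).trans hs
  have hX : endSign b * arcX τ i s ≤ arcX τ i (halfLength τ c i) :=
    calc endSign b * arcX τ i s ≤ |arcX τ i s| := endSign_mul_le_abs b _
      _ = arcX τ i |s| := abs_arcX hτ i s
      _ ≤ arcX τ i (halfLength τ c i) := monotoneOn_arcX hτ i (abs_nonneg s) hpos hs
  have hR : arcRise τ i s ≤ arcRise τ i (halfLength τ c i) := by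
    rw [← arcRise_abs hτ i s]
    exact (strictMonoOn_arcRise hτ i).monotoneOn (abs_nonneg s) hpos hs
  have hend := inner_normal_arcPoint_end hτ hi true
  simp only [endSign, if_true, one_mul, inner_normal_arcPoint_self] at hend
  rw [inner_normal_arcPoint_self, ← hend]
  have hi : 0 ≤ τ i := (hτ i).1.le
  linear_combination √(1 - τ i ^ 2) * hX + τ i * hR

theorem inner_normal_arcPoint_le (hτ : ∀ i, 0 < τ i ∧ τ i ≤ 1) (hc : ∀ i, bendLevel τ i < c i)
    (j i : Fin 2) (b : Bool) {s : ℝ} (hs : |s| ≤ halfLength τ c i) :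
    inner ℝ (normal τ j b) (arcPoint τ i s) ≤ c j := by
  rcases eq_or_ne j i with rfl | hij
  · exact inner_normal_arcPoint_self_le hτ (hc j) b hs
  · obtain rfl : i = j.rev := eq_rev_of_ne hij
    rw [inner_normal_arcPoint_rev hτ]
    exact (sub_le_self _ (mul_nonneg (hτ j).1.le (arcRise_nonneg hτ _ s))).trans (hc j).le

theorem claspConfig_eq (τ c : Fin 2 → ℝ) (i : Fin 2) (t : I) :
    claspConfig τ c i t = arcPoint τ i ((2 * (t : ℝ) - 1) * halfLength τ c i) := rfl

/-- The parameter in the unit interval of the point `arcPoint τ i s`. -/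
def unitParam (τ c : Fin 2 → ℝ) (i : Fin 2) (s : ℝ) : I :=
  projIcc 0 1 zero_le_one ((1 + s / halfLength τ c i) / 2)

theorem coe_unitParam {i : Fin 2} (hl : 0 < halfLength τ c i) {s : ℝ}
    (hs : |s| ≤ halfLength τ c i) : (unitParam τ c i s : ℝ) = (1 + s / halfLength τ c i) / 2 := by
  have hratio : -1 ≤ s / halfLength τ c i ∧ s / halfLength τ c i ≤ 1 := by
    rw [← abs_le, abs_div, abs_of_pos hl]
    exact (div_le_one hl).2 hs
  rw [unitParam, projIcc_of_mem zero_le_one ⟨by linarith, by linarith⟩]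

theorem claspConfig_unitParam {i : Fin 2} (hi : 0 ≤ τ i) (hci : bendLevel τ i < c i)
    {s : ℝ} (hs : |s| ≤ halfLength τ c i) :
    claspConfig τ c i (unitParam τ c i s) = arcPoint τ i s := by
  have hpos : 0 < halfLength τ c i := hi.trans_lt (lt_halfLength hci)
  rw [claspConfig_eq, coe_unitParam hpos hs]
  congr 1
  field_simp
  ring

theorem dist_unitParam_eq_one (hτ : ∀ i, 0 < τ i ∧ τ i ≤ 1) (hc : ∀ i, bendLevel τ i < c i)
    {u v : ℝ} (h : Balanced τ 0 u v) :
    dist (claspConfig τ c 0 (unitParam τ c 0 u)) (claspConfig τ c 1 (unitParam τ c 1 v)) = 1 := by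
  rw [claspConfig_unitParam (hτ 0).1.le (hc 0) ((h.abs_left_le hτ).trans (lt_halfLength (hc 0)).le),
    claspConfig_unitParam (hτ 1).1.le (hc 1)
      ((h.abs_right_le hτ).trans (lt_halfLength (hc 1)).le),
    dist_arcPoint_eq_one hτ h]

theorem one_le_dist_claspConfig (hτ : ∀ i, 0 < τ i ∧ τ i ≤ 1) (c : Fin 2 → ℝ) {i j : Fin 2}
    (hij : i ≠ j) (s t : I) : 1 ≤ dist (claspConfig τ c i s) (claspConfig τ c j t) := by
  fin_cases i <;> fin_cases j
  · exact absurd rfl hij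
  · exact one_le_dist_arcPoint hτ _ _
  · rw [dist_comm]
    exact one_le_dist_arcPoint hτ _ _
  · exact absurd rfl hij

theorem gThi_claspConfig (hτ : ∀ i, 0 < τ i ∧ τ i ≤ 1) (hc : ∀ i, bendLevel τ i < c i) :
    gThi (claspConfig τ c) = 1 := by
  have htip : Balanced τ 0 (τ 0) 0 := by
    rw [Balanced, abs_of_pos (hτ 0).1, abs_zero, zero_div, add_zero, div_self (hτ 0).1.ne']
  exact gThi_eq_of_forall_le_dist (fun _ _ hij => one_le_dist_claspConfig hτ c hij) zero_ne_one
    (dist_unitParam_eq_one hτ hc htip)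

theorem one_le_tipHeight (hτ : ∀ i, 0 < τ i ∧ τ i ≤ 1) : 1 ≤ tipHeight τ 1 := by
  have hnonneg : 0 ≤ tipHeight τ 1 := by
    have hrise := arcRise_nonneg hτ 1 (τ 1)
    rw [arcRise_of_abs_le (abs_of_pos (hτ 1).1).le] at hrise
    rw [tipHeight_one_eq hτ 1]
    exact add_nonneg (Real.sqrt_nonneg _) hrise
  refine (one_le_sq_iff₀ hnonneg).1 ?_
  calc (1 : ℝ) ≤ dist (arcPoint τ 0 0) (arcPoint τ 1 0) ^ 2 :=
        one_le_pow₀ (one_le_dist_arcPoint hτ 0 0)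
    _ = tipHeight τ 1 ^ 2 := by
        rw [dist_arcPoint_sq, arcX_zero hτ, arcX_zero hτ, arcRise_zero hτ, arcRise_zero hτ]
        ring

theorem contDiff_obstacle (τ c : Fin 2 → ℝ) (k : Fin 2 × Bool) :
    ContDiff ℝ 1 ((claspConstraints τ c).obstacle k) :=
  contDiff_const.sub (contDiff_const.inner ℝ contDiff_id)

theorem fderiv_obstacle_ne_zero (hτ : ∀ i, 0 < τ i ∧ τ i ≤ 1) (c : Fin 2 → ℝ)
    (k : Fin 2 × Bool) (p : E3) : fderiv ℝ ((claspConstraints τ c).obstacle k) p ≠ 0 := by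
  have hderiv : HasFDerivAt ((claspConstraints τ c).obstacle k)
      (-innerSL ℝ (normal τ k.1 k.2)) p :=
    (innerSL ℝ (normal τ k.1 k.2)).hasFDerivAt.const_sub (c k.1)
  rw [hderiv.fderiv, neg_ne_zero, ← norm_ne_zero_iff, innerSL_apply_norm, norm_normal hτ]
  exact one_ne_zero

theorem mem_endpoint_iff (hτ : ∀ i, 0 < τ i ∧ τ i ≤ 1) (c : Fin 2 → ℝ) (i : Fin 2) (b : Bool)
    (p : E3) : p ∈ (claspConstraints τ c).endpoint i b ↔ inner ℝ (normal τ i b) p = c i := by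
  change p ∈ AffineSubspace.mk' (c i • normal τ i b) (ℝ ∙ normal τ i b)ᗮ ↔ _
  rw [AffineSubspace.mem_mk', Submodule.mem_orthogonal_singleton_iff_inner_right, vsub_eq_sub,
    inner_sub_right, inner_smul_right, real_inner_self_eq_norm_sq, norm_normal hτ, one_pow,
    mul_one, sub_eq_zero]

end Levels

section Isotopy

variable {τ c : Fin 2 → ℝ}

theorem halfLength_pos {i : Fin 2} (hi : 0 < τ i) (hci : bendLevel τ i < c i) :
    0 < halfLength τ c i := hi.trans (lt_halfLength hci)

theorem exists_eq_endSign_mul_abs (x : ℝ) : ∃ b, x = endSign b * |x| := by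
  rcases abs_choice x with h | h
  · exact ⟨true, by simp [endSign, h]⟩
  · exact ⟨false, by simp [endSign, h]⟩

theorem abs_two_mul_sub_one_le (t : I) : |2 * (t : ℝ) - 1| ≤ 1 :=
  abs_le.2 ⟨by linarith [t.2.1], by linarith [t.2.2]⟩

theorem convex_setOf_inner_le (n : E3) (a : ℝ) : Convex ℝ {p | inner ℝ n p ≤ a} :=
  convex_halfSpace_le (innerₗ E3 n).isLinear a

/-- The hook with the same tip and the same endpoints as the `i`th arc. -/
def straightHook (τ c : Fin 2 → ℝ) (i : Fin 2) : I → E3 :=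
  hookArc (arcX τ i (halfLength τ c i)) (tipHeight τ i)
    (tipHeight τ i + updown i * arcRise τ i (halfLength τ c i)) i

/-- The straight-line homotopy from the arcs to the hooks. -/
def hookHomotopy (τ c : Fin 2 → ℝ) (r : I) (i : Fin 2) (t : I) : E3 :=
  (1 - (r : ℝ)) • claspConfig τ c i t + (r : ℝ) • straightHook τ c i t

/-- The horizontal coordinate of `hookHomotopy`, as a function of `q = 2 t - 1`. -/
def homotopyX (τ c : Fin 2 → ℝ) (i : Fin 2) (r q : ℝ) : ℝ :=
  (1 - r) * arcX τ i (q * halfLength τ c i) + r * (q * arcX τ i (halfLength τ c i))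

/-- The height of `hookHomotopy` over the tip, as a function of `q = 2 t - 1`. -/
def homotopyRise (τ c : Fin 2 → ℝ) (i : Fin 2) (r q : ℝ) : ℝ :=
  (1 - r) * arcRise τ i (q * halfLength τ c i) + r * (|q| * arcRise τ i (halfLength τ c i))

theorem hookHomotopy_eq (τ c : Fin 2 → ℝ) (r : I) (i : Fin 2) (t : I) :
    hookHomotopy τ c r i t = planePoint i (homotopyX τ c i r (2 * t - 1))
      (tipHeight τ i + updown i * homotopyRise τ c i r (2 * t - 1)) := by
  rw [hookHomotopy, claspConfig_eq, arcPoint_eq, straightHook, hookArc, smul_planePoint,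
    smul_planePoint, planePoint_add, homotopyX, homotopyRise]
  congr 1
  ring

theorem homotopyX_neg (hτ : ∀ i, 0 < τ i ∧ τ i ≤ 1) (c : Fin 2 → ℝ) (i : Fin 2) (r q : ℝ) :
    homotopyX τ c i r (-q) = -homotopyX τ c i r q := by
  rw [homotopyX, neg_mul, arcX_neg hτ, homotopyX]
  ring

theorem homotopyX_pos (hτ : ∀ i, 0 < τ i ∧ τ i ≤ 1) {i : Fin 2} (hi : bendLevel τ i < c i)
    (r : I) {q : ℝ} (hq : 0 < q) : 0 < homotopyX τ c i r q := by
  have hl : 0 < halfLength τ c i := halfLength_pos (hτ i).1 hi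
  exact convex_Ioi (0 : ℝ) (arcX_pos hτ i (mul_pos hq hl)) (mul_pos hq (arcX_pos hτ i hl))
    (sub_nonneg.2 r.2.2) r.2.1 (sub_add_cancel _ _)

theorem eq_zero_of_homotopyX_eq_zero (hτ : ∀ i, 0 < τ i ∧ τ i ≤ 1) {i : Fin 2}
    (hi : bendLevel τ i < c i) (r : I) {q : ℝ} (h : homotopyX τ c i r q = 0) : q = 0 := by
  rcases lt_trichotomy q 0 with hq | hq | hq
  · have hpos := homotopyX_pos hτ hi r (neg_pos.2 hq)
    rw [homotopyX_neg hτ, h, neg_zero] at hpos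
    exact absurd hpos (lt_irrefl 0)
  · exact hq
  · exact absurd h (homotopyX_pos hτ hi r hq).ne'

theorem homotopyRise_zero (hτ : ∀ i, 0 < τ i ∧ τ i ≤ 1) (c : Fin 2 → ℝ) (i : Fin 2) (r : ℝ) :
    homotopyRise τ c i r 0 = 0 := by
  rw [homotopyRise, zero_mul, arcRise_zero hτ, abs_zero, zero_mul, mul_zero, mul_zero, add_zero]

theorem homotopyRise_lt (hτ : ∀ i, 0 < τ i ∧ τ i ≤ 1) {i : Fin 2} (hi : bendLevel τ i < c i)
    (r : I) {p q : ℝ} (hpq : |p| < |q|) :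
    homotopyRise τ c i r p < homotopyRise τ c i r q := by
  have hl : 0 < halfLength τ c i := halfLength_pos (hτ i).1 hi
  have hmono := strictMonoOn_arcRise hτ i
  have harc : arcRise τ i (p * halfLength τ c i) < arcRise τ i (q * halfLength τ c i) := by
    rw [← arcRise_abs hτ, ← arcRise_abs hτ i (q * _), abs_mul, abs_mul, abs_of_pos hl]
    exact hmono (mem_Ici.2 (by positivity)) (mem_Ici.2 (by positivity))
      (mul_lt_mul_of_pos_right hpq hl)
  have hend : 0 < arcRise τ i (halfLength τ c i) := by
    rw [← arcRise_zero hτ i]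
    exact hmono self_mem_Ici hl.le hl
  have hconvex := convex_Ioi (0 : ℝ) (sub_pos.2 harc)
    (sub_pos.2 (mul_lt_mul_of_pos_right hpq hend)) (sub_nonneg.2 r.2.2) r.2.1
    (sub_add_cancel _ _)
  rw [mem_Ioi, smul_eq_mul, smul_eq_mul] at hconvex
  unfold homotopyRise
  linarith

theorem injective_hookHomotopy (hτ : ∀ i, 0 < τ i ∧ τ i ≤ 1) {i : Fin 2}
    (hi : bendLevel τ i < c i) (r : I) : Function.Injective (hookHomotopy τ c r i) := by
  intro s t hst
  rw [hookHomotopy_eq, hookHomotopy_eq] at hst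
  obtain ⟨hx, hz⟩ := planePoint_inj hst
  have hrise : homotopyRise τ c i r (2 * s - 1) = homotopyRise τ c i r (2 * t - 1) :=
    mul_left_cancel₀ (left_ne_zero_of_mul_eq_one (updown_mul_self i)) (add_left_cancel hz)
  have habs : |2 * (s : ℝ) - 1| = |2 * (t : ℝ) - 1| :=
    le_antisymm (le_of_not_gt fun h => (homotopyRise_lt hτ hi r h).ne' hrise)
      (le_of_not_gt fun h => (homotopyRise_lt hτ hi r h).ne hrise)
  rcases abs_eq_abs.1 habs with h | h
  · exact Subtype.ext (by linarith)
  · rw [h, homotopyX_neg hτ] at hx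
    have hmid := eq_zero_of_homotopyX_eq_zero hτ hi r (q := 2 * t - 1) (by linarith)
    exact Subtype.ext (by linarith)

theorem continuous_hookHomotopy (hτ : ∀ i, 0 < τ i ∧ τ i ≤ 1) (c : Fin 2 → ℝ) (i : Fin 2) :
    Continuous fun q : I × I => hookHomotopy τ c q.1 i q.2 := by
  have hX := continuous_arcX hτ i
  have hR := continuous_arcRise hτ i
  simp only [hookHomotopy_eq, homotopyX, homotopyRise]
  exact continuous_planePoint i (by fun_prop) (by fun_prop)

theorem hookHomotopy_end (hτ : ∀ i, 0 < τ i ∧ τ i ≤ 1) (c : Fin 2 → ℝ) (r : I) (i : Fin 2)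
    {b : Bool} {t : I} (ht : 2 * (t : ℝ) - 1 = endSign b) :
    hookHomotopy τ c r i t = arcPoint τ i (endSign b * halfLength τ c i) := by
  rw [hookHomotopy_eq, arcPoint_eq, ht, homotopyX, homotopyRise]
  cases b
  · simp only [endSign, Bool.false_eq_true, if_false, neg_mul, one_mul, arcX_neg hτ,
      arcRise_neg hτ, abs_neg, abs_one]
    congr 1 <;> ring
  · simp only [endSign, if_true, one_mul, abs_one]
    congr 1 <;> ring

theorem exists_straightHook_eq (hτ : ∀ i, 0 < τ i ∧ τ i ≤ 1) (c : Fin 2 → ℝ) (i : Fin 2) (t : I) :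
    ∃ b, straightHook τ c i t = (1 - |2 * (t : ℝ) - 1|) • arcPoint τ i 0 +
      |2 * (t : ℝ) - 1| • arcPoint τ i (endSign b * halfLength τ c i) := by
  obtain ⟨b, hb⟩ := exists_eq_endSign_mul_abs (2 * (t : ℝ) - 1)
  refine ⟨b, ?_⟩
  have hX : arcX τ i (endSign b * halfLength τ c i) = endSign b * arcX τ i (halfLength τ c i) := by
    cases b <;> simp [endSign, arcX_neg hτ]
  have hR : arcRise τ i (endSign b * halfLength τ c i) = arcRise τ i (halfLength τ c i) := by
    cases b <;> simp [endSign, arcRise_neg hτ]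
  rw [straightHook, hookArc, arcPoint_eq, arcPoint_eq, smul_planePoint, smul_planePoint,
    planePoint_add, arcX_zero hτ, arcRise_zero hτ, hX, hR]
  congr 1
  · linear_combination arcX τ i (halfLength τ c i) * hb
  · ring

theorem abs_param_le {i : Fin 2} (hi : 0 < halfLength τ c i) (t : I) :
    |(2 * (t : ℝ) - 1) * halfLength τ c i| ≤ halfLength τ c i := by
  rw [abs_mul, abs_of_pos hi]
  exact mul_le_of_le_one_left hi.le (abs_two_mul_sub_one_le t)

theorem inner_normal_hookHomotopy_le (hτ : ∀ i, 0 < τ i ∧ τ i ≤ 1)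
    (hc : ∀ i, bendLevel τ i < c i) (j i : Fin 2) (b : Bool) (r t : I) :
    inner ℝ (normal τ j b) (hookHomotopy τ c r i t) ≤ c j := by
  have hl : 0 < halfLength τ c i := halfLength_pos (hτ i).1 (hc i)
  have hconvex := convex_setOf_inner_le (normal τ j b) (c j)
  obtain ⟨b', hb'⟩ := exists_straightHook_eq hτ c i t
  have htip : inner ℝ (normal τ j b) (arcPoint τ i 0) ≤ c j :=
    inner_normal_arcPoint_le hτ hc j i b (by rw [abs_zero]; exact hl.le)
  have hend : inner ℝ (normal τ j b) (arcPoint τ i (endSign b' * halfLength τ c i)) ≤ c j :=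
    inner_normal_arcPoint_le hτ hc j i b
      (by rw [abs_mul, abs_endSign, one_mul, abs_of_pos hl])
  have harc : inner ℝ (normal τ j b) (claspConfig τ c i t) ≤ c j :=
    inner_normal_arcPoint_le hτ hc j i b (abs_param_le hl t)
  have hhook : inner ℝ (normal τ j b) (straightHook τ c i t) ≤ c j := by
    rw [hb']
    exact hconvex htip hend (sub_nonneg.2 (abs_two_mul_sub_one_le t)) (abs_nonneg _)
      (sub_add_cancel _ _)
  exact hconvex harc hhook (sub_nonneg.2 r.2.2) r.2.1 (sub_add_cancel _ _)

theorem tipHeight_zero_lt_tipHeight_one (hτ : ∀ i, 0 < τ i ∧ τ i ≤ 1) :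
    tipHeight τ 0 < tipHeight τ 1 := one_pos.trans_le (one_le_tipHeight hτ)

theorem tipHeight_injective (hτ : ∀ i, 0 < τ i ∧ τ i ≤ 1) : Function.Injective (tipHeight τ) := by
  have h := tipHeight_zero_lt_tipHeight_one hτ
  intro i j hij
  fin_cases i <;> fin_cases j
  · rfl
  · exact absurd hij h.ne
  · exact absurd hij h.ne'
  · rfl

theorem inner_normal_tip_lt (hτ : ∀ i, 0 < τ i ∧ τ i ≤ 1) {j : Fin 2} (hj : bendLevel τ j < c j)
    (i : Fin 2) (b : Bool) : inner ℝ (normal τ j b) (planePoint i 0 (tipHeight τ i)) < c j := by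
  have hle : updown j * tipHeight τ i ≤ updown j * tipHeight τ j.rev := by
    have h := (tipHeight_zero_lt_tipHeight_one hτ).le
    fin_cases j <;> fin_cases i <;> simp [updown, h]
  calc inner ℝ (normal τ j b) (planePoint i 0 (tipHeight τ i))
      = τ j * (updown j * tipHeight τ i) := by
        rw [normal, inner_planePoint, mul_zero, ite_self]
        ring
    _ ≤ τ j * (updown j * tipHeight τ j.rev) := mul_le_mul_of_nonneg_left hle (hτ j).1.le
    _ = bendLevel τ j := by rw [bendLevel_eq hτ]; ring
    _ < c j := hj

theorem isGeneralizedLink_hookHomotopy (hτ : ∀ i, 0 < τ i ∧ τ i ≤ 1)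
    (hc : ∀ i, bendLevel τ i < c i) (r : I) :
    IsGeneralizedLink (claspConstraints τ c) (hookHomotopy τ c r) where
  obstacle_contDiff := contDiff_obstacle τ c
  obstacle_regular k p _ := fderiv_obstacle_ne_zero hτ c k p
  continuous i := (continuous_hookHomotopy hτ c i).comp (by fun_prop : Continuous fun t => (r, t))
  disjoint i j hij s t h := by
    -- Arcs in perpendicular planes can only meet on the `z`-axis, which they cross at their tips.
    rw [hookHomotopy_eq, hookHomotopy_eq] at h
    obtain ⟨hi, hj, hz⟩ := planePoint_eq_planePoint_of_ne hij h
    rw [eq_zero_of_homotopyX_eq_zero hτ (hc i) r hi, eq_zero_of_homotopyX_eq_zero hτ (hc j) r hj,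
      homotopyRise_zero hτ, homotopyRise_zero hτ, mul_zero, mul_zero, add_zero, add_zero] at hz
    exact hij (tipHeight_injective hτ hz)
  start_mem i := by
    rw [mem_endpoint_iff hτ, hookHomotopy_end hτ c r i (b := false) (by simp [endSign]),
      inner_normal_arcPoint_end hτ (hc i)]
  end_mem i := by
    rw [mem_endpoint_iff hτ, hookHomotopy_end hτ c r i (b := true) (by norm_num [endSign]),
      inner_normal_arcPoint_end hτ (hc i)]
  avoids k i t := sub_nonneg.2 (inner_normal_hookHomotopy_le hτ hc k.1 i k.2 r t)

theorem hookHomotopy_zero (τ c : Fin 2 → ℝ) : hookHomotopy τ c 0 = claspConfig τ c := by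
  funext i t
  simp [hookHomotopy]

theorem hookHomotopy_one (τ c : Fin 2 → ℝ) : hookHomotopy τ c 1 = straightHook τ c := by
  funext i t
  simp [hookHomotopy]

theorem isGeneralizedLink_claspConfig (hτ : ∀ i, 0 < τ i ∧ τ i ≤ 1)
    (hc : ∀ i, bendLevel τ i < c i) :
    IsGeneralizedLink (claspConstraints τ c) (claspConfig τ c) := by
  rw [← hookHomotopy_zero]
  exact isGeneralizedLink_hookHomotopy hτ hc 0

theorem inClaspClass_claspConfig (hτ : ∀ i, 0 < τ i ∧ τ i ≤ 1)
    (hc : ∀ i, bendLevel τ i < c i) : InClaspClass τ c (claspConfig τ c) :=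
  ⟨fun i => arcX τ i (halfLength τ c i), tipHeight τ,
    fun i => tipHeight τ i + updown i * arcRise τ i (halfLength τ c i),
    fun i => arcX_pos hτ i (halfLength_pos (hτ i).1 (hc i)), tipHeight_zero_lt_tipHeight_one hτ,
    fun i j => inner_normal_tip_lt hτ (hc j) i,
    hookHomotopy τ c, continuous_hookHomotopy hτ c, hookHomotopy_zero τ c, hookHomotopy_one τ c,
    fun r => ⟨isGeneralizedLink_hookHomotopy hτ hc r, fun i => injective_hookHomotopy hτ (hc i) r⟩⟩

end Isotopy

section Tangent

variable {τ : Fin 2 → ℝ}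

/-- The unit tangent of the `i`th clasp curve: `u` is the sine of its angle to the horizontal. -/
def tangent (τ : Fin 2 → ℝ) (i : Fin 2) (s : ℝ) : E3 :=
  planePoint i √(1 - clampU τ i s ^ 2) (updown i * clampU τ i s)

/-- The speed of the `i`th clasp curve in its parameter `s`. -/
def speed (τ : Fin 2 → ℝ) (i : Fin 2) (s : ℝ) : ℝ :=
  if |s| < τ i then curvedSpeed τ i |s| else 1

/-- The derivative of the unit tangent of the `i`th clasp curve with respect to its parameter `s`,
that is, the density of the curvature force; it vanishes along the straight ends. -/
def bend (τ : Fin 2 → ℝ) (i : Fin 2) (s : ℝ) : E3 :=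
  if |s| < τ i then planePoint i (-s / √(1 - s ^ 2)) (updown i) else 0

theorem continuous_tangent (τ : Fin 2 → ℝ) (i : Fin 2) : Continuous (tangent τ i) := by
  have h := continuous_clampU τ i
  exact continuous_planePoint i (by fun_prop) (by fun_prop)

theorem norm_tangent (hτ : ∀ i, 0 < τ i ∧ τ i ≤ 1) (i : Fin 2) (s : ℝ) :
    ‖tangent τ i s‖ = 1 := by
  have hclamp := one_sub_sq_nonneg hτ i (abs_le.2 (clampU_mem_Icc (hτ i).1.le s))
  have hsq : ‖tangent τ i s‖ ^ 2 = 1 := by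
    rw [tangent, norm_sq_planePoint, mul_pow, Real.sq_sqrt hclamp, sq (updown i), updown_mul_self]
    ring
  exact (pow_eq_one_iff_of_nonneg (norm_nonneg _) two_ne_zero).1 hsq

theorem speed_of_abs_lt {i : Fin 2} {s : ℝ} (hs : |s| < τ i) :
    speed τ i s = curvedSpeed τ i |s| :=
  if_pos hs

theorem speed_of_ge {i : Fin 2} {s : ℝ} (hs : τ i ≤ |s|) : speed τ i s = 1 :=
  if_neg hs.not_gt

theorem bend_of_abs_lt {i : Fin 2} {s : ℝ} (hs : |s| < τ i) :
    bend τ i s = planePoint i (-s / √(1 - s ^ 2)) (updown i) :=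
  if_pos hs

theorem bend_of_ge {i : Fin 2} {s : ℝ} (hs : τ i ≤ |s|) : bend τ i s = 0 :=
  if_neg hs.not_gt

theorem speed_pos (hτ : ∀ i, 0 < τ i ∧ τ i ≤ 1) (i : Fin 2) {s : ℝ} (hs : s ≠ 0) :
    0 < speed τ i s := by
  rcases lt_or_ge |s| (τ i) with h | h
  · rw [speed_of_abs_lt h]
    exact curvedSpeed_pos hτ i ⟨abs_pos.2 hs, h⟩
  · rw [speed_of_ge h]
    exact one_pos

theorem speed_neg (τ : Fin 2 → ℝ) (i : Fin 2) (s : ℝ) : speed τ i (-s) = speed τ i s := by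
  simp only [speed, abs_neg]

theorem hasDerivAt_const_add_sub_mul (a b m s : ℝ) :
    HasDerivAt (fun r => a + (r - b) * m) m s := by
  simpa using (((hasDerivAt_id s).sub_const b).mul_const m).const_add a

theorem hasDerivAt_arcX_of_pos (hτ : ∀ i, 0 < τ i ∧ τ i ≤ 1) (i : Fin 2) {s : ℝ} (hs : 0 < s)
    (hs' : s ≠ τ i) : HasDerivAt (arcX τ i) (√(1 - clampU τ i s ^ 2) * speed τ i s) s := by
  rcases hs'.lt_or_gt with h | h
  · have habs : |s| < τ i := by rwa [abs_of_pos hs]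
    rw [clampU_of_abs_le habs.le, speed_of_abs_lt habs, abs_of_pos hs,
      sqrt_mul_curvedSpeed hτ i ⟨hs, h⟩]
    refine (hasDerivAt_claspX hτ i ⟨hs, h⟩).congr_of_eventuallyEq ?_
    filter_upwards [Ioo_mem_nhds hs h] with r hr
    exact arcX_of_abs_le (abs_lt_of_mem_Ioo_zero hr).le
  · rw [clampU_of_ge (hτ i).1.le h.le, speed_of_ge (h.le.trans (le_abs_self s)), mul_one]
    refine (hasDerivAt_const_add_sub_mul (τ i) (τ i) _ s).congr_of_eventuallyEq ?_
    filter_upwards [lt_mem_nhds h] with r hr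
    exact arcX_of_ge (hτ i).1 hr.le

theorem hasDerivAt_arcRise_of_pos (hτ : ∀ i, 0 < τ i ∧ τ i ≤ 1) (i : Fin 2) {s : ℝ}
    (hs : 0 < s) (hs' : s ≠ τ i) :
    HasDerivAt (arcRise τ i) (clampU τ i s * speed τ i s) s := by
  rcases hs'.lt_or_gt with h | h
  · have habs : |s| < τ i := by rwa [abs_of_pos hs]
    rw [clampU_of_abs_le habs.le, speed_of_abs_lt habs, abs_of_pos hs]
    refine (hasDerivAt_claspRise hτ i ⟨hs, h⟩).congr_of_eventuallyEq ?_
    filter_upwards [Ioo_mem_nhds hs h] with r hr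
    exact arcRise_of_abs_le (abs_lt_of_mem_Ioo_zero hr).le
  · rw [clampU_of_ge (hτ i).1.le h.le, speed_of_ge (h.le.trans (le_abs_self s)), mul_one]
    refine (hasDerivAt_const_add_sub_mul (claspRise τ i (τ i)) (τ i) _ s).congr_of_eventuallyEq ?_
    filter_upwards [lt_mem_nhds h] with r hr
    exact arcRise_of_ge (hτ i).1 hr.le

theorem hasDerivAt_arcX (hτ : ∀ i, 0 < τ i ∧ τ i ≤ 1) (i : Fin 2) {s : ℝ} (h0 : s ≠ 0)
    (hs : |s| ≠ τ i) : HasDerivAt (arcX τ i) (√(1 - clampU τ i s ^ 2) * speed τ i s) s := by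
  rcases h0.lt_or_gt with h | h
  · rw [abs_of_neg h] at hs
    have hneg := ((hasDerivAt_arcX_of_pos hτ i (neg_pos.2 h) hs).scomp s (hasDerivAt_neg s)).neg
    have hodd : -(arcX τ i ∘ Neg.neg) = arcX τ i := by
      funext r
      simp only [Pi.neg_apply, Function.comp_apply, arcX_neg hτ, neg_neg]
    rw [hodd, clampU_neg hτ, neg_sq, speed_neg, neg_smul, one_smul, neg_neg] at hneg
    exact hneg
  · rw [abs_of_pos h] at hs
    exact hasDerivAt_arcX_of_pos hτ i h hs

theorem hasDerivAt_arcRise (hτ : ∀ i, 0 < τ i ∧ τ i ≤ 1) (i : Fin 2) {s : ℝ} (h0 : s ≠ 0)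
    (hs : |s| ≠ τ i) : HasDerivAt (arcRise τ i) (clampU τ i s * speed τ i s) s := by
  rcases h0.lt_or_gt with h | h
  · rw [abs_of_neg h] at hs
    have hneg := (hasDerivAt_arcRise_of_pos hτ i (neg_pos.2 h) hs).scomp s (hasDerivAt_neg s)
    have heven : arcRise τ i ∘ Neg.neg = arcRise τ i := by
      funext r
      exact arcRise_neg hτ i r
    rw [heven, clampU_neg hτ, speed_neg, neg_smul, one_smul, neg_mul, neg_neg] at hneg
    exact hneg
  · rw [abs_of_pos h] at hs
    exact hasDerivAt_arcRise_of_pos hτ i h hs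

theorem hasDerivAt_arcPoint (hτ : ∀ i, 0 < τ i ∧ τ i ≤ 1) (i : Fin 2) {s : ℝ} (h0 : s ≠ 0)
    (hs : |s| ≠ τ i) : HasDerivAt (arcPoint τ i) (speed τ i s • tangent τ i s) s := by
  have hz := ((hasDerivAt_arcRise hτ i h0 hs).const_mul (updown i)).const_add (tipHeight τ i)
  refine (hasDerivAt_planePoint i (hasDerivAt_arcX hτ i h0 hs) hz).congr_deriv ?_
  rw [tangent, smul_planePoint]
  congr 1 <;> ring

theorem hasDerivAt_tangent_of_abs_lt (hτ : ∀ i, 0 < τ i ∧ τ i ≤ 1) (i : Fin 2) {s : ℝ}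
    (hs : |s| < τ i) : HasDerivAt (tangent τ i) (bend τ i s) s := by
  rw [bend_of_abs_lt hs]
  have hpos := one_sub_sq_pos hτ i hs
  have hx := ((hasDerivAt_pow 2 s).const_sub 1).sqrt hpos.ne'
  have hz := (hasDerivAt_id s).const_mul (updown i)
  refine ((hasDerivAt_planePoint i hx hz).congr_of_eventuallyEq ?_).congr_deriv ?_
  · filter_upwards [continuous_abs.continuousAt.eventually_lt continuousAt_const hs] with r hr
    simp only [tangent, clampU_of_abs_le hr.le, id]
  · congr 1
    · have := (Real.sqrt_pos.2 hpos).ne'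
      push_cast
      field_simp
    · ring

theorem hasDerivAt_tangent_of_gt (hτ : ∀ i, 0 < τ i ∧ τ i ≤ 1) (i : Fin 2) {s : ℝ}
    (hs : τ i < |s|) : HasDerivAt (tangent τ i) (bend τ i s) s := by
  rw [bend_of_ge hs.le]
  suffices ∀ᶠ r in 𝓝 s, clampU τ i r = clampU τ i s by
    refine (hasDerivAt_const s (tangent τ i s)).congr_of_eventuallyEq ?_
    filter_upwards [this] with r hr
    simp only [tangent, hr]
  rcases lt_abs.1 hs with h | h
  · filter_upwards [lt_mem_nhds h] with r hr
    rw [clampU_of_ge (hτ i).1.le hr.le, clampU_of_ge (hτ i).1.le h.le]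
  · filter_upwards [gt_mem_nhds (lt_neg.1 h)] with r hr
    have hconst : ∀ q, τ i ≤ -q → clampU τ i q = -τ i := fun q hq => by
      rw [← neg_neg q, clampU_neg hτ, clampU_of_ge (hτ i).1.le hq]
    rw [hconst r (lt_neg.1 hr).le, hconst s h.le]

theorem hasDerivAt_tangent (hτ : ∀ i, 0 < τ i ∧ τ i ≤ 1) (i : Fin 2) {s : ℝ}
    (hs : |s| ≠ τ i) : HasDerivAt (tangent τ i) (bend τ i s) s :=
  hs.lt_or_gt.elim (hasDerivAt_tangent_of_abs_lt hτ i) (hasDerivAt_tangent_of_gt hτ i)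

theorem intervalIntegrable_of_symmetric {E : Type*} [NormedAddCommGroup E] {f : ℝ → E} {L : ℝ}
    (hf : ∀ l, L ≤ l → IntervalIntegrable f volume (-l) l) (a b : ℝ) :
    IntervalIntegrable f volume a b := by
  set l := max L (max |a| |b|)
  have ha : |a| ≤ l := (le_max_left _ _).trans (le_max_right _ _)
  have hb : |b| ≤ l := (le_max_right _ _).trans (le_max_right _ _)
  exact (hf l (le_max_left _ _)).mono_set
    (uIcc_subset_uIcc (Icc_subset_uIcc (abs_le.1 ha)) (Icc_subset_uIcc (abs_le.1 hb)))

theorem intervalIntegrable_speed (hτ : ∀ i, 0 < τ i ∧ τ i ≤ 1) (i : Fin 2) (a b : ℝ) :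
    IntervalIntegrable (speed τ i) volume a b := by
  refine intervalIntegrable_of_symmetric (L := τ i) (fun l hl => ?_) a b
  have hcurved : IntervalIntegrable (speed τ i) volume 0 (τ i) := by
    refine (intervalIntegrable_curvedSpeed hτ i).congr_uIoo fun s hs => ?_
    rw [uIoo_of_le (hτ i).1.le] at hs
    rw [speed_of_abs_lt (abs_lt_of_mem_Ioo_zero hs), abs_of_pos hs.1]
  have hstraight : IntervalIntegrable (speed τ i) volume (τ i) l := by
    refine (intervalIntegrable_const (c := (1 : ℝ))).congr_uIoo fun s hs => ?_
    rw [uIoo_of_le hl] at hs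
    exact (speed_of_ge (hs.1.le.trans (le_abs_self s))).symm
  have hright := hcurved.trans hstraight
  have hleft : IntervalIntegrable (speed τ i) volume (-l) 0 := by
    have := ((IntervalIntegrable.iff_comp_neg (by finiteness)).1 hright).symm
    simpa only [speed_neg, neg_zero] using this
  exact hleft.trans hright

theorem intervalIntegrable_one_div_sqrt_one_sub_sq {a : ℝ} (h0 : 0 ≤ a) (h1 : a ≤ 1) :
    IntervalIntegrable (fun s : ℝ => 1 / √(1 - s ^ 2)) volume (-a) a := by
  refine intervalIntegral.intervalIntegrable_deriv_of_nonneg (g := Real.arcsin)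
    Real.continuous_arcsin.continuousOn (fun s hs => ?_) fun _ _ => by positivity
  rw [min_eq_left (by linarith), max_eq_right (by linarith)] at hs
  exact Real.hasDerivAt_arcsin (by linarith [hs.1]) (by linarith [hs.2])

theorem intervalIntegrable_bend_curved (hτ : ∀ i, 0 < τ i ∧ τ i ≤ 1) (i : Fin 2) :
    IntervalIntegrable (bend τ i) volume (-τ i) (τ i) := by
  have hcont : Continuous fun s => planePoint i (-s) (updown i * √(1 - s ^ 2)) :=
    continuous_planePoint i (by fun_prop) (by fun_prop)
  refine ((intervalIntegrable_one_div_sqrt_one_sub_sq (hτ i).1.le (hτ i).2).smul_continuousOn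
    hcont.continuousOn).congr_uIoo fun s hs => ?_
  rw [uIoo_of_le (by linarith [(hτ i).1])] at hs
  have hsqrt := (Real.sqrt_pos.2 (one_sub_sq_pos hτ i (abs_lt.2 hs))).ne'
  simp only [bend_of_abs_lt (abs_lt.2 hs), smul_planePoint]
  congr 1 <;> field_simp

theorem intervalIntegrable_bend (hτ : ∀ i, 0 < τ i ∧ τ i ≤ 1) (i : Fin 2) (a b : ℝ) :
    IntervalIntegrable (bend τ i) volume a b := by
  refine intervalIntegrable_of_symmetric (L := τ i) (fun l hl => ?_) a b
  have hzero : ∀ a b, (∀ s ∈ uIoo a b, τ i ≤ |s|) → IntervalIntegrable (bend τ i) volume a b :=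
    fun a b h => (intervalIntegrable_const (c := (0 : E3))).congr_uIoo fun s hs =>
      (bend_of_ge (h s hs)).symm
  have hright := hzero (τ i) l fun s hs => by
    rw [uIoo_of_le hl] at hs
    exact hs.1.le.trans (le_abs_self s)
  have hleft := hzero (-l) (-τ i) fun s hs => by
    rw [uIoo_of_le (neg_le_neg hl)] at hs
    exact (le_neg.2 hs.2.le).trans (neg_le_abs s)
  exact (hleft.trans (intervalIntegrable_bend_curved hτ i)).trans hright

end Tangent

section Force

variable {τ : Fin 2 → ℝ}

theorem arcPoint_sub_arcPoint (hτ : ∀ i, 0 < τ i ∧ τ i ≤ 1) (i : Fin 2) (a b : ℝ) :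
    arcPoint τ i b - arcPoint τ i a = ∫ s in a..b, speed τ i s • tangent τ i s := by
  refine (integral_eq_of_hasDerivAt_off_countable _ _ (s := {0, τ i, -τ i})
    (Set.toFinite _).countable (continuous_arcPoint hτ i).continuousOn (fun s hs => ?_)
    ((intervalIntegrable_speed hτ i a b).smul_continuousOn
      (continuous_tangent τ i).continuousOn)).symm
  have hs' := hs.2
  simp only [mem_insert_iff, mem_singleton_iff, not_or, ← abs_eq (hτ i).1.le] at hs'
  exact hasDerivAt_arcPoint hτ i hs'.1 hs'.2

theorem integral_inner_tangent_deriv (hτ : ∀ i, 0 < τ i ∧ τ i ≤ 1) (i : Fin 2) {F : ℝ → E3}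
    (hF : ContDiff ℝ 1 F) (a b : ℝ) :
    ∫ s in a..b, inner ℝ (tangent τ i s) (deriv F s) =
      inner ℝ (tangent τ i b) (F b) - inner ℝ (tangent τ i a) (F a) -
        ∫ s in a..b, inner ℝ (F s) (bend τ i s) := by
  have hT := continuous_tangent τ i
  have hvary : IntervalIntegrable (fun s => inner ℝ (tangent τ i s) (deriv F s)) volume a b :=
    (hT.inner (hF.continuous_deriv le_rfl)).intervalIntegrable a b
  have hturn : IntervalIntegrable (fun s => inner ℝ (F s) (bend τ i s)) volume a b :=
    intervalIntegrable_inner hF.continuous (intervalIntegrable_bend hτ i a b)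
  rw [eq_sub_iff_add_eq, ← intervalIntegral.integral_add hvary hturn]
  refine integral_eq_of_hasDerivAt_off_countable (fun s => inner ℝ (tangent τ i s) (F s)) _
    (s := {τ i, -τ i}) (Set.toFinite _).countable (hT.inner hF.continuous).continuousOn
    (fun s hs => ?_) (hvary.add hturn)
  have hs' := hs.2
  simp only [mem_insert_iff, mem_singleton_iff, ← abs_eq (hτ i).1.le] at hs'
  refine ((hasDerivAt_tangent hτ i hs').inner ℝ
    (hF.differentiable one_ne_zero s).hasDerivAt).congr_deriv ?_
  rw [real_inner_comm (F s)]

theorem smul_integral_comp_two_mul_sub_one_mul {E : Type*} [NormedAddCommGroup E]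
    [NormedSpace ℝ E] (f : ℝ → E) (l a b : ℝ) :
    (2 * l) • ∫ t in a..b, f ((2 * t - 1) * l) = ∫ s in (2 * a - 1) * l..(2 * b - 1) * l, f s := by
  have h := intervalIntegral.smul_integral_comp_mul_sub (a := a) (b := b) f (2 * l) l
  have harg : ∀ t : ℝ, 2 * l * t - l = (2 * t - 1) * l := fun t => by ring
  simpa only [harg] using h

theorem intervalIntegrable_comp_two_mul_sub_one_mul {E : Type*} [NormedAddCommGroup E]
    {f : ℝ → E} {l : ℝ} (hl : 0 < l) (hf : IntervalIntegrable f volume (-l) l) :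
    IntervalIntegrable (fun t => f ((2 * t - 1) * l)) volume 0 1 := by
  have h := (hf.comp_mul_right (c := 2 * l)).comp_sub_right (1 / 2)
  have hleft : -l / (2 * l) + 1 / 2 = 0 := by field_simp; ring
  have hright : l / (2 * l) + 1 / 2 = 1 := by field_simp; ring
  rw [hleft, hright] at h
  refine h.congr fun t _ => ?_
  congr 1
  ring

theorem hasVelocity_arcPoint (hτ : ∀ i, 0 < τ i ∧ τ i ≤ 1) (i : Fin 2) {l : ℝ} (hl : 0 < l) :
    HasVelocity (fun t => arcPoint τ i ((2 * t - 1) * l))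
      fun t => (2 * l) • speed τ i ((2 * t - 1) * l) • tangent τ i ((2 * t - 1) * l) where
  integrable :=
    (intervalIntegrable_comp_two_mul_sub_one_mul hl
      ((intervalIntegrable_speed hτ i _ _).smul_continuousOn
        (continuous_tangent τ i).continuousOn)).smul (2 * l)
  sub_eq_integral s t := by
    rw [intervalIntegral.integral_smul, arcPoint_sub_arcPoint hτ]
    exact (smul_integral_comp_two_mul_sub_one_mul
      (fun s => speed τ i s • tangent τ i s) l s t).symm

theorem hasDerivAt_len_arcPoint (hτ : ∀ i, 0 < τ i ∧ τ i ≤ 1) (i : Fin 2) {l : ℝ} (hl : 0 < l)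
    {f : ℝ → E3} (hf : ContDiff ℝ 1 f) :
    HasDerivAt (fun r : ℝ => len fun t => arcPoint τ i ((2 * t - 1) * l) + r • f t)
      (∫ t in (0 : ℝ)..1, inner ℝ (tangent τ i ((2 * t - 1) * l)) (deriv f t)) 0 := by
  refine (hasVelocity_arcPoint hτ i hl).hasDerivAt_toReal_eVariationOn
    ((continuous_tangent τ i).comp (by fun_prop)) (fun t => norm_tangent hτ i _) ?_ hf
  filter_upwards [(countable_singleton (1 / 2 : ℝ)).ae_notMem volume] with t ht _
  have ht0 : (2 * t - 1) * l ≠ 0 :=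
    mul_ne_zero (fun h => ht (by rw [mem_singleton_iff]; linarith)) hl.ne'
  exact ⟨2 * l * speed τ i ((2 * t - 1) * l), mul_pos (by positivity) (speed_pos hτ i ht0),
    (mul_smul _ _ _).symm⟩

theorem integral_inner_tangent_comp (hτ : ∀ i, 0 < τ i ∧ τ i ≤ 1) (i : Fin 2) {l : ℝ}
    (hl : 0 < l) {f : ℝ → E3} (hf : ContDiff ℝ 1 f) :
    ∫ t in (0 : ℝ)..1, inner ℝ (tangent τ i ((2 * t - 1) * l)) (deriv f t) =
      inner ℝ (tangent τ i l) (f 1) - inner ℝ (tangent τ i (-l)) (f 0) -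
        ∫ s in -l..l, inner ℝ (f ((1 + s / l) / 2)) (bend τ i s) := by
  set F : ℝ → E3 := fun s => f ((1 + s / l) / 2) with hF_def
  have hF : ContDiff ℝ 1 F := hf.comp (by fun_prop)
  have hmid (t : ℝ) : (1 + (2 * t - 1) * l / l) / 2 = t := by field_simp; ring
  have hderiv (t : ℝ) : (2 * l) • deriv F ((2 * t - 1) * l) = deriv f t := by
    have haff : HasDerivAt (fun s : ℝ => (1 + s / l) / 2) (1 / l / 2) ((2 * t - 1) * l) :=
      (((hasDerivAt_id _).div_const l).const_add 1).div_const 2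
    have hf' := (hf.differentiable one_ne_zero ((1 + (2 * t - 1) * l / l) / 2)).hasDerivAt
    have hFd : HasDerivAt F _ ((2 * t - 1) * l) :=
      HasDerivAt.scomp (h := fun s => (1 + s / l) / 2) _ hf' haff
    rw [hFd.deriv, hmid, smul_smul]
    exact (congrArg (· • deriv f t) (by field_simp)).trans (one_smul ℝ _)
  have hends : F (-l) = f 0 ∧ F l = f 1 := by
    simp only [hF_def, neg_div, div_self hl.ne']
    norm_num
  calc ∫ t in (0 : ℝ)..1, inner ℝ (tangent τ i ((2 * t - 1) * l)) (deriv f t)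
      = (2 * l) • ∫ t in (0 : ℝ)..1,
          inner ℝ (tangent τ i ((2 * t - 1) * l)) (deriv F ((2 * t - 1) * l)) := by
        simp only [← hderiv, real_inner_smul_right, intervalIntegral.integral_const_mul,
          smul_eq_mul]
    _ = ∫ s in -l..l, inner ℝ (tangent τ i s) (deriv F s) := by
        rw [smul_integral_comp_two_mul_sub_one_mul fun s => inner ℝ (tangent τ i s) (deriv F s)]
        norm_num
    _ = _ := by rw [integral_inner_tangent_deriv hτ i hF, hends.1, hends.2]

variable {c : Fin 2 → ℝ}

theorem continuous_unitParam (τ c : Fin 2 → ℝ) (i : Fin 2) : Continuous (unitParam τ c i) :=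
  continuous_projIcc.comp (by fun_prop)

theorem intervalIntegrable_inner_bend (hτ : ∀ i, 0 < τ i ∧ τ i ≤ 1) (c : Fin 2 → ℝ) (i : Fin 2)
    (ξ : C(I, E3)) (a b : ℝ) :
    IntervalIntegrable (fun s => inner ℝ (ξ (unitParam τ c i s)) (bend τ i s)) volume a b :=
  intervalIntegrable_inner (ξ.continuous.comp (continuous_unitParam τ c i))
    (intervalIntegrable_bend hτ i a b)

/-- The absolutely continuous part of the curvature force of the `i`th arc, as a functional on
vector fields along the arc. -/
def bendForce (hτ : ∀ i, 0 < τ i ∧ τ i ≤ 1) (c : Fin 2 → ℝ) (i : Fin 2) : C(I, E3) →L[ℝ] ℝ :=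
  LinearMap.mkContinuous
    { toFun := fun ξ => ∫ s in -halfLength τ c i..halfLength τ c i,
        inner ℝ (ξ (unitParam τ c i s)) (bend τ i s)
      map_add' := fun ξ η => by
        simp only [ContinuousMap.add_apply, inner_add_left]
        exact intervalIntegral.integral_add (intervalIntegrable_inner_bend hτ c i ξ _ _)
          (intervalIntegrable_inner_bend hτ c i η _ _)
      map_smul' := fun r ξ => by
        simp only [ContinuousMap.smul_apply, real_inner_smul_left, RingHom.id_apply, smul_eq_mul]
        exact intervalIntegral.integral_const_mul _ _ }
    |∫ s in -halfLength τ c i..halfLength τ c i, ‖bend τ i s‖| fun ξ => by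
      rw [← abs_norm ξ, ← abs_mul, ← intervalIntegral.integral_mul_const]
      refine intervalIntegral.norm_integral_le_abs_of_norm_le (Eventually.of_forall fun s => ?_)
        ((intervalIntegrable_bend hτ i _ _).norm.mul_const _)
      rw [mul_comm]
      exact (norm_inner_le_norm _ _).trans
        (mul_le_mul_of_nonneg_right (ξ.norm_coe_le_norm _) (norm_nonneg _))

/-- The curvature force of the `i`th arc. The first variation of length of a curve with unit
tangent `T` is `⟨T, ξ⟩` at its final minus its initial endpoint, minus the integral of `⟨ξ, T'⟩`. -/
def curvatureForce (hτ : ∀ i, 0 < τ i ∧ τ i ≤ 1) (c : Fin 2 → ℝ) (i : Fin 2) :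
    C(I, E3) →L[ℝ] ℝ :=
  bendForce hτ c i -
    (innerSL ℝ (tangent τ i (halfLength τ c i))).comp (ContinuousMap.evalCLM ℝ (1 : I)) +
    (innerSL ℝ (tangent τ i (-halfLength τ c i))).comp (ContinuousMap.evalCLM ℝ (0 : I))

theorem curvatureForce_apply (hτ : ∀ i, 0 < τ i ∧ τ i ≤ 1) (c : Fin 2 → ℝ) (i : Fin 2)
    (ξ : C(I, E3)) : curvatureForce hτ c i ξ =
      (∫ s in -halfLength τ c i..halfLength τ c i,
        inner ℝ (ξ (unitParam τ c i s)) (bend τ i s)) -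
      inner ℝ (tangent τ i (halfLength τ c i)) (ξ 1) +
      inner ℝ (tangent τ i (-halfLength τ c i)) (ξ 0) := rfl

theorem isCurvatureForce_claspConfig (hτ : ∀ i, 0 < τ i ∧ τ i ≤ 1) {i : Fin 2}
    (hi : bendLevel τ i < c i) :
    IsCurvatureForce (claspConfig τ c i) (curvatureForce hτ c i) := by
  have hl := halfLength_pos (hτ i).1 hi
  refine ⟨(hasVelocity_arcPoint hτ i hl).eVariationOn_ne_top, fun ξ f hf hξ => ?_⟩
  have hforce : ∫ s in -halfLength τ c i..halfLength τ c i,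
        inner ℝ (f ((1 + s / halfLength τ c i) / 2)) (bend τ i s) =
      ∫ s in -halfLength τ c i..halfLength τ c i,
        inner ℝ (ξ (unitParam τ c i s)) (bend τ i s) := by
    refine intervalIntegral.integral_congr fun s hs => ?_
    rw [uIcc_of_le (neg_le_self hl.le)] at hs
    simp only [hξ, coe_unitParam hl (abs_le.2 hs)]
  have hlen := hasDerivAt_len_arcPoint hτ i hl hf
  rw [integral_inner_tangent_comp hτ i hl hf] at hlen
  have hends : f 0 = ξ 0 ∧ f 1 = ξ 1 := ⟨(hξ 0).symm, (hξ 1).symm⟩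
  rw [hforce, hends.1, hends.2] at hlen
  simp only [← hξ] at hlen
  refine hlen.congr_deriv ?_
  rw [curvatureForce_apply]
  ring

end Force

section Criticality

variable {τ c : Fin 2 → ℝ}

theorem tangent_endSign_mul_halfLength (hτ : ∀ i, 0 < τ i ∧ τ i ≤ 1) {i : Fin 2}
    (hi : bendLevel τ i < c i) (b : Bool) :
    tangent τ i (endSign b * halfLength τ c i) = endSign b • normal τ i b := by
  have hclamp := clampU_of_ge (hτ i).1.le (lt_halfLength hi).le
  rw [normal_eq, smul_planePoint, tangent]
  cases b <;> simp [endSign, clampU_neg hτ, hclamp]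

theorem Compatible.inner_normal_eq_zero {ξ : Fin 2 → C(I, E3)}
    (h : Compatible (claspConstraints τ c) ξ) (i : Fin 2) :
    inner ℝ (normal τ i false) (ξ i 0) = 0 ∧ inner ℝ (normal τ i true) (ξ i 1) = 0 := by
  simpa only [claspConstraints, AffineSubspace.direction_mk',
    Submodule.mem_orthogonal_singleton_iff_inner_right] using h i

theorem intervalIntegrable_comp_const_mul {f : ℝ → ℝ}
    (hf : ∀ a b, IntervalIntegrable f volume a b) {r : ℝ} (hr : r ≠ 0) (a b : ℝ) :
    IntervalIntegrable (fun x => f (r * x)) volume a b := by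
  simpa only [mul_div_cancel_left₀ _ hr] using
    (hf (r * a) (r * b)).comp_mul_left (c := r) (by finiteness) (by finiteness)

theorem integral_symm_eq_mul_integral_sum {f : ℝ → ℝ} {a l : ℝ} (ha : 0 < a) (hal : a ≤ l)
    (hf : ∀ b c, IntervalIntegrable f volume b c) (hzero : ∀ s, a ≤ |s| → f s = 0) :
    ∫ s in -l..l, f s = a * ∫ p in (0 : ℝ)..1, ∑ b, f (endSign b * (a * p)) := by
  have hoff {b : ℝ} (hab : a ≤ b) : ∫ s in a..b, f s = 0 := by
    rw [intervalIntegral.integral_congr (g := fun _ => 0) fun s hs => hzero s ?_,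
      intervalIntegral.integral_zero]
    rw [uIcc_of_le hab] at hs
    exact hs.1.trans (le_abs_self s)
  have hoff_neg : ∫ s in -l..-a, f s = 0 := by
    rw [intervalIntegral.integral_congr (g := fun _ => 0) fun s hs => hzero s ?_,
      intervalIntegral.integral_zero]
    rw [uIcc_of_le (neg_le_neg hal)] at hs
    exact (le_neg_of_le_neg hs.2).trans (neg_le_abs s)
  calc ∫ s in -l..l, f s = (∫ s in (0 : ℝ)..a, f s) + ∫ s in -a..0, f s := by
        rw [← intervalIntegral.integral_add_adjacent_intervals (hf (-l) (-a)) (hf (-a) l),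
          ← intervalIntegral.integral_add_adjacent_intervals (hf (-a) 0) (hf 0 l),
          ← intervalIntegral.integral_add_adjacent_intervals (hf 0 a) (hf a l), hoff hal, hoff_neg]
        ring
    _ = a * ((∫ p in (0 : ℝ)..1, f (a * p)) + ∫ p in (0 : ℝ)..1, f (-a * p)) := by
        have hpos := intervalIntegral.smul_integral_comp_mul_left (a := 0) (b := 1) f a
        have hneg := intervalIntegral.smul_integral_comp_mul_left (a := 0) (b := 1) f (-a)
        simp only [mul_zero, mul_one, smul_eq_mul] at hpos hneg
        rw [intervalIntegral.integral_symm 0 (-a), ← hpos, ← hneg]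
        ring
    _ = a * ∫ p in (0 : ℝ)..1, ∑ b, f (endSign b * (a * p)) := by
        simp only [Fintype.sum_bool, endSign, if_true, Bool.false_eq_true, if_false, one_mul,
          neg_one_mul, ← neg_mul]
        rw [intervalIntegral.integral_add
          (intervalIntegrable_comp_const_mul hf ha.ne' 0 1)
          (intervalIntegrable_comp_const_mul hf (neg_ne_zero.2 ha.ne') 0 1)]

/-- The pairing of a vector field `ξ` along the `i`th arc with the curvature density, summed over
the two points of the arc with parameters `± τᵢ p`. -/
def bendPairing (τ c : Fin 2 → ℝ) (i : Fin 2) (ξ : C(I, E3)) (p : ℝ) : ℝ :=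
  ∑ b, inner ℝ (ξ (unitParam τ c i (endSign b * (τ i * p)))) (bend τ i (endSign b * (τ i * p)))

theorem intervalIntegrable_bendPairing (hτ : ∀ i, 0 < τ i ∧ τ i ≤ 1) (c : Fin 2 → ℝ) (i : Fin 2)
    (ξ : C(I, E3)) : IntervalIntegrable (bendPairing τ c i ξ) volume 0 1 := by
  have hpair (b : Bool) := intervalIntegrable_comp_const_mul
    (intervalIntegrable_inner_bend hτ c i ξ)
    (mul_ne_zero (endSign_ne_zero b) (hτ i).1.ne') 0 1
  simp only [mul_assoc] at hpair
  have hsum : bendPairing τ c i ξ = fun p => _ + _ := funext fun p => Fintype.sum_bool _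
  rw [hsum]
  exact (hpair true).add (hpair false)

theorem integral_inner_bend_eq (hτ : ∀ i, 0 < τ i ∧ τ i ≤ 1) {i : Fin 2}
    (hi : bendLevel τ i < c i) (ξ : C(I, E3)) :
    ∫ s in -halfLength τ c i..halfLength τ c i, inner ℝ (ξ (unitParam τ c i s)) (bend τ i s) =
      τ i * ∫ p in (0 : ℝ)..1, bendPairing τ c i ξ p :=
  integral_symm_eq_mul_integral_sum (hτ i).1 (lt_halfLength hi).le
    (intervalIntegrable_inner_bend hτ c i ξ) fun s hs => by rw [bend_of_ge hs, inner_zero_right]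

/-- The density of the weighted first variation of length at `p ∈ [0, 1]`, where `p` stands for the
four struts between the points `u₁ = ± τ₁ p` and `u₂ = ± τ₂ (1 - p)`. -/
def strutDensity (τ c : Fin 2 → ℝ) (ξ : Fin 2 → C(I, E3)) (p : ℝ) : ℝ :=
  -(bendPairing τ c 0 (ξ 0) p + bendPairing τ c 1 (ξ 1) (1 - p))

theorem intervalIntegrable_bendPairing_one_sub (hτ : ∀ i, 0 < τ i ∧ τ i ≤ 1) (c : Fin 2 → ℝ)
    (i : Fin 2) (ξ : C(I, E3)) :
    IntervalIntegrable (fun p => bendPairing τ c i ξ (1 - p)) volume 0 1 := by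
  simpa using ((intervalIntegrable_bendPairing hτ c i ξ).comp_sub_left 1 (by finiteness)).symm

theorem intervalIntegrable_strutDensity (hτ : ∀ i, 0 < τ i ∧ τ i ≤ 1) (c : Fin 2 → ℝ)
    (ξ : Fin 2 → C(I, E3)) : IntervalIntegrable (strutDensity τ c ξ) volume 0 1 :=
  ((intervalIntegrable_bendPairing hτ c 0 (ξ 0)).add
    (intervalIntegrable_bendPairing_one_sub hτ c 1 (ξ 1))).neg

theorem Compatible.curvatureForce_eq (hτ : ∀ i, 0 < τ i ∧ τ i ≤ 1)
    {ξ : Fin 2 → C(I, E3)} (h : Compatible (claspConstraints τ c) ξ) {i : Fin 2}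
    (hi : bendLevel τ i < c i) :
    curvatureForce hτ c i (ξ i) = τ i * ∫ p in (0 : ℝ)..1, bendPairing τ c i (ξ i) p := by
  have hstart := tangent_endSign_mul_halfLength hτ hi false
  have hend := tangent_endSign_mul_halfLength hτ hi true
  simp only [endSign, Bool.false_eq_true, if_false, if_true, one_mul, neg_one_mul, one_smul]
    at hstart hend
  rw [curvatureForce_apply, integral_inner_bend_eq hτ hi, hstart, hend, real_inner_smul_left,
    (h.inner_normal_eq_zero i).1, (h.inner_normal_eq_zero i).2]
  ring

theorem Compatible.sum_weighted_variation_eq (hτ : ∀ i, 0 < τ i ∧ τ i ≤ 1)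
    (hc : ∀ i, bendLevel τ i < c i) {ξ : Fin 2 → C(I, E3)}
    (h : Compatible (claspConstraints τ c) ξ) :
    ∑ i, 1 / τ i * -(curvatureForce hτ c i (ξ i)) = ∫ p in (0 : ℝ)..1, strutDensity τ c ξ p := by
  have hcancel (i : Fin 2) : 1 / τ i * -(curvatureForce hτ c i (ξ i)) =
      -∫ p in (0 : ℝ)..1, bendPairing τ c i (ξ i) p := by
    have hτi := (hτ i).1.ne'
    rw [h.curvatureForce_eq hτ (hc i)]
    field_simp
  have hreflect := intervalIntegral.integral_comp_sub_left (a := 0) (b := 1)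
    (bendPairing τ c 1 (ξ 1)) 1
  rw [sub_zero, sub_self] at hreflect
  simp only [strutDensity]
  rw [Fin.sum_univ_two, hcancel, hcancel, intervalIntegral.integral_neg,
    intervalIntegral.integral_add (intervalIntegrable_bendPairing hτ c 0 (ξ 0))
      (intervalIntegrable_bendPairing_one_sub hτ c 1 (ξ 1)), hreflect]
  ring

theorem planePoint_zero_left (i j : Fin 2) (z : ℝ) : planePoint i 0 z = planePoint j 0 z := by
  fin_cases i <;> fin_cases j <;> simp [planePoint_eq]

/-- The two struts at a point of one arc are mirror images in the plane of that arc, so they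
add up to a vector in that plane; the shape of the arcs makes it a multiple of the curvature. -/
theorem Balanced.sum_struts (hτ : ∀ i, 0 < τ i ∧ τ i ≤ 1) {i : Fin 2} {u v : ℝ}
    (h : Balanced τ i u v) (hu : |u| < τ i) :
    ∑ b, (arcPoint τ i u - arcPoint τ i.rev (endSign b * v)) =
      (-(2 * strutHeight u v)) • bend τ i u := by
  have hclosed := h.claspRise_add_claspRise_add_strutHeight hτ
  have hinclination := h.claspX_mul_sqrt hτ
  have hmirror : ∑ b, arcPoint τ i.rev (endSign b * v) =
      planePoint i 0 (2 * (tipHeight τ i.rev + updown i.rev * claspRise τ i.rev v)) := by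
    simp only [Fintype.sum_bool, endSign, if_true, Bool.false_eq_true, if_false, one_mul,
      neg_one_mul, arcPoint_eq, arcX_neg hτ, arcRise_neg hτ, planePoint_add, add_neg_cancel,
      arcRise_of_abs_le (h.abs_right_le hτ), ← two_mul]
    exact planePoint_zero_left _ _ _
  have htips : tipHeight τ i.rev - tipHeight τ i = updown i * tipHeight τ 1 := by
    fin_cases i <;> simp [tipHeight, updown]
  have hupdown : updown i.rev = -updown i := by fin_cases i <;> simp [updown]
  have hsqrt : √(1 - u ^ 2) ≠ 0 := (Real.sqrt_pos.2 (one_sub_sq_pos hτ i hu)).ne'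
  rw [Finset.sum_sub_distrib, hmirror, Finset.sum_const, Finset.card_univ, Fintype.card_bool,
    ← Nat.cast_smul_eq_nsmul ℝ, arcPoint_eq, arcX_of_abs_le hu.le, arcRise_of_abs_le hu.le,
    bend_of_abs_lt hu, smul_planePoint, smul_planePoint, planePoint_sub]
  congr 1
  · field_simp
    push_cast
    linear_combination 2 * hinclination
  · linear_combination 2 * updown i * hclosed - 2 * htips - 2 * claspRise τ i.rev v * hupdown

/-- The derivative of half the squared length of the segment between the points with parameters
`u` and `v` when the arcs are moved along `ξ`. -/
def strutRate (τ c : Fin 2 → ℝ) (ξ : Fin 2 → C(I, E3)) (u v : ℝ) : ℝ :=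
  inner ℝ (arcPoint τ 0 u - arcPoint τ 1 v)
    (ξ 0 (unitParam τ c 0 u) - ξ 1 (unitParam τ c 1 v))

theorem Balanced.endSign_mul_left {i : Fin 2} {u v : ℝ} (h : Balanced τ i u v) (b : Bool) :
    Balanced τ i (endSign b * u) v := by
  rwa [Balanced, abs_mul, abs_endSign, one_mul]

theorem Balanced.endSign_mul_right {i : Fin 2} {u v : ℝ} (h : Balanced τ i u v) (b : Bool) :
    Balanced τ i u (endSign b * v) := by
  rwa [Balanced, abs_mul, abs_endSign, one_mul]

theorem strutHeight_endSign_mul_left (b : Bool) (u v : ℝ) :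
    strutHeight (endSign b * u) v = strutHeight u v := by
  rw [strutHeight, mul_pow, sq (endSign b), endSign_mul_self, one_mul, strutHeight]

theorem mul_mem_Ioo_zero {a p : ℝ} (ha : 0 < a) (hp : p ∈ Ioo (0 : ℝ) 1) : a * p ∈ Ioo 0 a :=
  ⟨mul_pos ha hp.1, mul_lt_of_lt_one_right ha hp.2⟩

theorem balanced_mul_mul_one_sub (hτ : ∀ i, 0 < τ i ∧ τ i ≤ 1) {p : ℝ} (hp : p ∈ Ioo (0 : ℝ) 1) :
    Balanced τ 0 (τ 0 * p) (τ 1 * (1 - p)) := by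
  have h0 := (hτ 0).1
  have h1 := (hτ 1).1
  change |τ 0 * p| / τ 0 + |τ 1 * (1 - p)| / τ 1 = 1
  rw [abs_of_pos (mul_pos h0 hp.1), abs_of_pos (mul_pos h1 (sub_pos.2 hp.2)),
    mul_div_cancel_left₀ _ h0.ne', mul_div_cancel_left₀ _ h1.ne', add_sub_cancel]

theorem strutHeight_mul_pos (hτ : ∀ i, 0 < τ i ∧ τ i ≤ 1) {p : ℝ} (hp : p ∈ Ioo (0 : ℝ) 1) :
    0 < strutHeight (τ 0 * p) (τ 1 * (1 - p)) := by
  have hpos := strutHeight_partner_pos hτ 0 (mul_mem_Ioo_zero (hτ 0).1 hp)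
  rwa [(balanced_mul_mul_one_sub hτ hp).partner_eq hτ,
    abs_of_pos (mul_pos (hτ 1).1 (sub_pos.2 hp.2))] at hpos

theorem strutHeight_mul_bendPairing (hτ : ∀ i, 0 < τ i ∧ τ i ≤ 1) (c : Fin 2 → ℝ) (i : Fin 2)
    (ξ : C(I, E3)) {p v : ℝ} (h : Balanced τ i (τ i * p) v) (hp : |τ i * p| < τ i) :
    2 * strutHeight (τ i * p) v * bendPairing τ c i ξ p =
      -∑ b, ∑ b', inner ℝ
        (arcPoint τ i (endSign b * (τ i * p)) - arcPoint τ i.rev (endSign b' * v))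
        (ξ (unitParam τ c i (endSign b * (τ i * p)))) := by
  simp only [bendPairing, Finset.mul_sum, ← sum_inner, ← Finset.sum_neg_distrib]
  refine Finset.sum_congr rfl fun b _ => ?_
  rw [(h.endSign_mul_left b).sum_struts hτ (by rwa [abs_mul, abs_endSign, one_mul]),
    strutHeight_endSign_mul_left, real_inner_smul_left, real_inner_comm]
  ring

theorem strutHeight_mul_strutDensity (hτ : ∀ i, 0 < τ i ∧ τ i ≤ 1) (c : Fin 2 → ℝ)
    (ξ : Fin 2 → C(I, E3)) {p : ℝ} (hp : p ∈ Ioo (0 : ℝ) 1) :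
    2 * strutHeight (τ 0 * p) (τ 1 * (1 - p)) * strutDensity τ c ξ p =
      ∑ b, ∑ b', strutRate τ c ξ (endSign b * (τ 0 * p)) (endSign b' * (τ 1 * (1 - p))) := by
  have hbal := balanced_mul_mul_one_sub hτ hp
  have hp' : 1 - p ∈ Ioo (0 : ℝ) 1 := ⟨sub_pos.2 hp.2, sub_lt_self 1 hp.1⟩
  have hzero := strutHeight_mul_bendPairing hτ c 0 (ξ 0) hbal
    (abs_lt_of_mem_Ioo_zero (mul_mem_Ioo_zero (hτ 0).1 hp))
  have hone := strutHeight_mul_bendPairing hτ c 1 (ξ 1) hbal.symm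
    (abs_lt_of_mem_Ioo_zero (mul_mem_Ioo_zero (hτ 1).1 hp'))
  rw [strutHeight_comm] at hone
  have hrev : Fin.rev (0 : Fin 2) = 1 ∧ Fin.rev (1 : Fin 2) = 0 := ⟨rfl, rfl⟩
  simp only [hrev, Fintype.sum_bool, strutDensity, strutRate, inner_sub_left, inner_sub_right]
    at hzero hone ⊢
  linear_combination -hzero - hone

/-- The position vector field along the clasp, whose flow dilates the clasp. -/
def positionField (hτ : ∀ i, 0 < τ i ∧ τ i ≤ 1) (c : Fin 2 → ℝ) (i : Fin 2) : C(I, E3) :=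
  ⟨claspConfig τ c i, (continuous_arcPoint hτ i).comp (by fun_prop)⟩

section RoomForTheArcs

variable (hτ : ∀ i, 0 < τ i ∧ τ i ≤ 1) (hc : ∀ i, bendLevel τ i < c i)

include hτ hc

theorem Balanced.claspConfig_unitParam_sub {u v : ℝ} (h : Balanced τ 0 u v) :
    claspConfig τ c 0 (unitParam τ c 0 u) - claspConfig τ c 1 (unitParam τ c 1 v) =
      arcPoint τ 0 u - arcPoint τ 1 v := by
  rw [claspConfig_unitParam (hτ 0).1.le (hc 0) ((h.abs_left_le hτ).trans (lt_halfLength (hc 0)).le),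
    claspConfig_unitParam (hτ 1).1.le (hc 1)
      ((h.abs_right_le hτ).trans (lt_halfLength (hc 1)).le)]

theorem Balanced.strutRate_positionField {u v : ℝ} (h : Balanced τ 0 u v) :
    strutRate τ c (positionField hτ c) u v = 1 := by
  have hfield (i : Fin 2) (t : I) : positionField hτ c i t = claspConfig τ c i t := rfl
  rw [strutRate, hfield, hfield, h.claspConfig_unitParam_sub hτ hc, real_inner_self_eq_norm_sq,
    ← dist_eq_norm, dist_arcPoint_eq_one hτ h, one_pow]

theorem strutHeight_mul_strutDensity_positionField {p : ℝ} (hp : p ∈ Ioo (0 : ℝ) 1) :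
    2 * strutHeight (τ 0 * p) (τ 1 * (1 - p)) * strutDensity τ c (positionField hτ c) p = 4 := by
  have hone (b b' : Bool) := (((balanced_mul_mul_one_sub hτ hp).endSign_mul_left
    b).endSign_mul_right b').strutRate_positionField hτ hc
  rw [strutHeight_mul_strutDensity hτ c _ hp]
  simp only [hone, Fintype.sum_bool]
  norm_num

theorem integral_strutDensity_positionField_pos :
    0 < ∫ p in (0 : ℝ)..1, strutDensity τ c (positionField hτ c) p := by
  refine intervalIntegral.intervalIntegral_pos_of_pos_on (intervalIntegrable_strutDensity hτ c _)
    (fun p hp => ?_) one_pos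
  refine pos_of_mul_pos_right ?_ (mul_pos two_pos (strutHeight_mul_pos hτ hp)).le
  rw [strutHeight_mul_strutDensity_positionField hτ hc hp]
  exact four_pos

theorem mul_integral_strutDensity_positionField_le {ξ : Fin 2 → C(I, E3)} {d : ℝ}
    (hd : ∀ u v, Balanced τ 0 u v → d ≤ strutRate τ c ξ u v) :
    d * ∫ p in (0 : ℝ)..1, strutDensity τ c (positionField hτ c) p ≤
      ∫ p in (0 : ℝ)..1, strutDensity τ c ξ p := by
  rw [← intervalIntegral.integral_const_mul]
  refine intervalIntegral.integral_mono_on_of_le_Ioo zero_le_one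
    ((intervalIntegrable_strutDensity hτ c _).const_mul d)
    (intervalIntegrable_strutDensity hτ c ξ) fun p hp => ?_
  have hrate (b b' : Bool) := hd _ _ (((balanced_mul_mul_one_sub hτ hp).endSign_mul_left
    b).endSign_mul_right b')
  refine le_of_mul_le_mul_left ?_ (mul_pos two_pos (strutHeight_mul_pos hτ hp))
  rw [mul_left_comm, strutHeight_mul_strutDensity_positionField hτ hc hp,
    strutHeight_mul_strutDensity hτ c ξ hp]
  simp only [Fintype.sum_bool]
  linarith [hrate true true, hrate true false, hrate false true, hrate false false]

theorem exists_hasOneSidedVariation_gThi_le_strutRate (ξ : Fin 2 → C(I, E3)) :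
    ∃ d, HasOneSidedVariation gThi (claspConfig τ c) ξ d ∧
      ∀ u v, Balanced τ 0 u v → d ≤ strutRate τ c ξ u v := by
  have hlink := isGeneralizedLink_claspConfig hτ hc
  obtain ⟨d, hd, hstruts⟩ := exists_hasOneSidedVariation_gThi hlink.continuous hlink.disjoint ξ
  refine ⟨d, hd, fun u v h => ?_⟩
  have hthi := gThi_claspConfig hτ hc
  have hle := hstruts 0 1 zero_ne_one _ _ ((dist_unitParam_eq_one hτ hc h).trans hthi.symm)
  rwa [hthi, div_one, h.claspConfig_unitParam_sub hτ hc] at hle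

theorem stronglyCritical_claspConfig :
    StronglyCritical (claspConstraints τ c) (fun i => 1 / τ i) (claspConfig τ c) := by
  have hcont := (isGeneralizedLink_claspConfig hτ hc).continuous
  have hpos := integral_strutDensity_positionField_pos hτ hc
  refine ⟨curvatureForce hτ c, fun i => isCurvatureForce_claspConfig hτ (hc i),
    1 / ∫ p in (0 : ℝ)..1, strutDensity τ c (positionField hτ c) p, one_div_pos.2 hpos,
    fun ξ hξ hlen => ?_⟩
  obtain ⟨dT, hT, hrate⟩ := exists_hasOneSidedVariation_gThi_le_strutRate hτ hc ξ
  obtain ⟨dO, hO⟩ := exists_hasOneSidedVariation_obstacleMin τ c hcont ξ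
  refine ⟨dT, dO, hT, hO, (min_le_left _ _).trans ?_⟩
  rw [← neg_div, le_div_iff₀ hpos, ← hlen, hξ.sum_weighted_variation_eq hτ hc]
  exact mul_integral_strutDensity_positionField_le hτ hc hrate

end RoomForTheArcs

end Criticality

end Clasp

end

theorem theorem3p1 (τ c : Fin 2 → ℝ) (hτ : ∀ i, 0 < τ i ∧ τ i ≤ 1)
    (hc : ∀ i, Clasp.bendLevel τ i < c i) :
    Clasp.IsGeneralizedLink (Clasp.claspConstraints τ c) (Clasp.claspConfig τ c) ∧
    Clasp.InClaspClass τ c (Clasp.claspConfig τ c) ∧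
    (∀ u v : ℝ, |u| ≤ τ 0 → |v| ≤ τ 1 → |u| / τ 0 + |v| / τ 1 = 1 →
      dist (Clasp.arcPoint τ 0 u) (Clasp.arcPoint τ 1 v) = 1) ∧
    Clasp.gThi (Clasp.claspConfig τ c) = 1 ∧
    Clasp.StronglyCritical (Clasp.claspConstraints τ c) (fun i => 1 / τ i)
      (Clasp.claspConfig τ c) := by
  exact ⟨Clasp.isGeneralizedLink_claspConfig hτ hc, Clasp.inClaspClass_claspConfig hτ hc,
    fun u v _ _ h => Clasp.dist_arcPoint_eq_one hτ h, Clasp.gThi_claspConfig hτ hc,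
    Clasp.stronglyCritical_claspConfig hτ hc⟩
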